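/- Let $N>2$ and let $P_1,\dots,P_N\in\mathbb R^2$ be distinct points. For $1\le i\le N-1$ let $\Gamma_i=\tau_i\,\mathcal H^1\llcorner\gamma_i$ be the $\mathbb R^2$-valued measure carried by the segment $\gamma_i=[P_i,P_N]$, where $\tau_i=\frac{P_N-P_i}{|P_N-P_i|}$. Let $SBV(\mathbb R^2;\mathbb Z^{N-1})$ be the set of $U=(u_1,\dots,u_{N-1})$ with integer-valued components $u_i\in SBV(\mathbb R^2)$, that is, $u_i\in L^1(\mathbb R^2)$, the distributional gradient $Du_i$ is a finite $\mathbb R^2$-valued measure, and its Cantor part (the restriction to the complement of the approximate discontinuity set of $u_i$ of the part of $Du_i$ singular with respect to Lebesgue measure) is zero. Write $Du_i^\perp$ for the measure obtained from $Du_i$ by the rotation $(v_1,v_2)^\perp=(-v_2,v_1)$, $|\cdot|$ for the total variation measure with respect to the Euclidean norm of $\mathbb R^2$, and $\sup_i$ for the supremum in the lattice of measures (the smallest positive measure dominating all of them), and set $$F^0(U)=\int_{\mathbb R^2}\sup_{1\le i\le N-1}|Du_i^\perp-\Gamma_i| .$$ Then there exists $U\in SBV(\mathbb R^2;\mathbb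 Z^{N-1})$ such that $$F^0(U)=\inf_{V\in SBV(\mathbb R^2;\mathbb Z^{N-1})}F^0(V) \qquad\text{and}\qquad \operatorname{spt}U\subset\Omega=\{x\in\mathbb R^2:\ |x|<10\max_{1\le i\le N}|P_i|\}.$$ -/

import Mathlib

open MeasureTheory Set Filter Topology
open scoped ENNReal ContDiff

noncomputable section

namespace PlanarSteiner

/-- The Euclidean plane. -/
abbrev Plane : Type := EuclideanSpace ℝ (Fin 2)

/-- The counterclockwise rotation by a right angle, `v ↦ v^⊥ = (-v₂, v₁)`. -/
def perp : Plane →L[ℝ] Plane := Matrix.toEuclideanCLM (𝕜 := ℝ) !![0, -1; 1, 0]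

theorem perp_apply (v : Plane) : perp v = !₂[-v 1, v 0] := by
  ext i
  fin_cases i <;>
    simp [perp, Matrix.ofLp_toEuclideanCLM, Matrix.mulVec, dotProduct, Fin.sum_univ_two]

/-- The (finite, countably additive) `ℝ²`-valued Borel measure `μ` represents the distributional
gradient of `u`: `∫ u ∇φ dx = - ∫ φ dμ` for every `φ ∈ C_c^∞(ℝ²)`. -/
def IsDistribGradient (u : Plane → ℝ) (μ : VectorMeasure Plane Plane) : Prop :=
  ∀ φ : Plane → ℝ, ContDiff ℝ ∞ φ → HasCompactSupport φ →
    ∫ x, u x • gradient φ x = - ∫ᵛ x, φ x ∂•μ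

/-- `u ∈ BV(ℝ²)`: `u ∈ L¹` and its distributional gradient is a finite vector measure. -/
structure MemBV (u : Plane → ℝ) : Prop where
  integrable : Integrable u
  exists_gradient : ∃ μ, IsDistribGradient u μ

open Classical in
/-- The vector measure `Du` of a function `u ∈ BV(ℝ²)` (and `0` if there is none). -/
def distribGradient (u : Plane → ℝ) : VectorMeasure Plane Plane :=
  if h : ∃ μ, IsDistribGradient u μ then h.choose else 0

theorem MemBV.isDistribGradient {u : Plane → ℝ} (hu : MemBV u) :
    IsDistribGradient u (distribGradient u) := by
  rw [distribGradient, dif_pos hu.exists_gradient]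
  exact hu.exists_gradient.choose_spec

/-- The approximate discontinuity set `S_u`: `x ∉ S_u` iff for some real `z` the average of
`|u - z|` over the ball `B_ρ(x)` tends to `0` as `ρ → 0⁺`. -/
def approxDiscSet (u : Plane → ℝ) : Set Plane :=
  {x | ¬ ∃ z : ℝ, Tendsto (fun ρ : ℝ => ⨍ y in Metric.ball x ρ, |u y - z|) (𝓝[>] 0) (𝓝 0)}

/-- `u ∈ SBV(ℝ²)`: `u ∈ BV(ℝ²)` and the Cantor part of `Du`, that is the restriction to
`ℝ² \ S_u` of the part of `Du` that is singular with respect to Lebesgue measure, vanishes.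
Equivalently, `Du` vanishes on every Lebesgue-null Borel set that does not meet `S_u`. -/
structure MemSBV (u : Plane → ℝ) : Prop extends MemBV u where
  cantor_eq_zero : ∀ B : Set Plane, MeasurableSet B → volume B = 0 →
    Disjoint B (approxDiscSet u) → distribGradient u B = 0

/-- `U = (u_1, …, u_n) ∈ SBV(ℝ²; ℤⁿ)`. -/
def MemSBVInt {n : ℕ} (U : Plane → Fin n → ℤ) : Prop :=
  ∀ i, MemSBV fun x => (U x i : ℝ)

/-- The orthogonal gradient `Du^⊥`. -/
def orthGradient (u : Plane → ℝ) : VectorMeasure Plane Plane :=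
  (distribGradient u).mapRange (perp : Plane →+ Plane) perp.continuous

/-- The vector measure `τ · H¹ ⌞ [p, q]`, where `τ = (q - p) / |q - p|` orients the segment from
`p` to `q`. -/
def segmentMeasure (p q : Plane) : VectorMeasure Plane Plane :=
  (μH[1].restrict (segment ℝ p q)).withDensityᵥ fun _ => ‖q - p‖⁻¹ • (q - p)

/-- The functional `F⁰(U) = ∫ sup_i |Du_i^⊥ - Γ_i|`, for the points `P 0, …, P n`, with
`Γ_i` the unit vector measure of the oriented segment from `P i` to the last point `P n`.
Here `|·|` is the total variation measure for the Euclidean norm of `ℝ²`, and the supremum is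
taken in the lattice of measures (the smallest measure dominating all of them). -/
def F0 {n : ℕ} (P : Fin (n + 1) → Plane) (U : Plane → Fin n → ℤ) : ℝ≥0∞ :=
  (⨆ i : Fin n, (orthGradient (fun x => (U x i : ℝ)) -
    segmentMeasure (P i.castSucc) (P (Fin.last n))).variation) univ

end PlanarSteiner

end

open MeasureTheory Set Filter Topology
open scoped ENNReal ContDiff

noncomputable section

/-! ### Vector measures with densities, and uniqueness of the distributional gradient. -/

namespace PlanarSteiner

/-! The direct method applies once the energy is written by duality. A finite measure `κ` dominates
every `|Du_i^⊥ - Γ_i|` exactly when, for each `i`, the pairing of `Du_i^⊥ - Γ_i` with any test field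
`w` is at most `∫ |w| dκ` in absolute value (`curlDominated_of_variation_le`,
`variation_le_of_curlDominated`). This pairing sees `u_i` only through `∫ u_i curl w`. So `F0` is
the least mass of such a `κ`, and the condition `CurlDominated` survives `L¹` convergence of the
`u_i` together with weak convergence of the `κ`.

Compactness needs a common bounded support. There is a smooth injective map `F` of the plane into a
ball of radius `9.9 M`, where `M = max |P_i|`; it contracts each coordinate and is the identity on
the ball of radius `M`. Replacing `u` by `u ∘ F⁻¹`, extended by zero, and `κ` by its image keeps the
domination, since pulling a field back by `F` shortens it and multiplies its curl by the Jacobian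
(`exists_truncation`). Integer values and the mass of `κ` are preserved, and the claim on the
support follows as well.

The planar Sobolev inequality and `|n| ≤ n²` bound the `L¹` norms. Mollification, with an `L¹` error
controlled by the total variation alone, and Arzelà–Ascoli give `L¹` compactness
(`exists_L1_limit`); Riesz–Markov gives weak limits of the `κ` (`exists_weak_limit`). All limits are
taken along one ultrafilter, so no subsequences are extracted.

The limit is a priori only BV, but integer-valued BV functions are SBV (`MemBV.memSBV_of_int`). At
`|Du|`-almost every point the function `m(r) = ∫_{B_r} |u - n|`, with `n` an integer, satisfies `√m
≤ const · m'`, by cutoffs, Sobolev and Lebesgue points. Hence `m` grows at least like `r²`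
(`HasGradDensity.exists_growth`), which excludes an approximate limit there, and `Du` is
concentrated on the approximate discontinuity set. -/

/-- Every plane-valued vector measure has an integrable density with respect to a finite positive
measure. -/
theorem exists_eq_withDensityᵥ (D : VectorMeasure Plane Plane) :
    ∃ (ν : Measure Plane) (k : Plane → Plane), IsFiniteMeasure ν ∧ Integrable k ν ∧
      D = ν.withDensityᵥ k := by
  let pr : Fin 2 → Plane →L[ℝ] ℝ := fun j => EuclideanSpace.proj j
  let s : Fin 2 → SignedMeasure Plane := fun j => D.mapRange (pr j : Plane →+ ℝ) (pr j).continuous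
  -- Both coordinates are absolutely continuous with respect to this sum, so Radon–Nikodym applies
  -- coordinate by coordinate.
  let ν : Measure Plane := (s 0).totalVariation + (s 1).totalVariation
  have hfin : IsFiniteMeasure ν := by infer_instance
  have hle : ∀ j, (s j).totalVariation ≤ ν := by
    intro j
    fin_cases j
    · exact Measure.le_add_right le_rfl
    · exact Measure.le_add_left le_rfl
  have hac : ∀ j, s j ≪ᵥ ν.toENNRealVectorMeasure := by
    intro j
    refine VectorMeasure.AbsolutelyContinuous.mk fun t ht h0 => ?_
    rw [Measure.toENNRealVectorMeasure_apply_measurable ht] at h0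
    have h1 := SignedMeasure.enorm_le_totalVariation (s j) t
    have h2 : (s j).totalVariation t = 0 := le_antisymm (by rw [← h0]; exact hle j t) bot_le
    rw [h2] at h1
    simpa using h1
  have hk : ∀ j, Integrable ((s j).rnDeriv ν) ν := fun j => SignedMeasure.integrable_rnDeriv _ _
  have hI : Integrable (fun x => WithLp.toLp 2 fun j => (s j).rnDeriv ν x : Plane → Plane) ν :=
    Integrable.of_eval_piLp hk
  refine ⟨ν, _, hfin, hI, ?_⟩
  ext t ht j
  rw [withDensityᵥ_apply hI ht]
  have h3 := SignedMeasure.withDensityᵥ_rnDeriv_eq (s j) ν (hac j)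
  have h4 : D t j = s j t := by
    rfl
  rw [h4, ← h3, withDensityᵥ_apply (hk j) ht]
  exact ((pr j).integral_comp_comm hI.integrableOn)

theorem isFiniteMeasure_variation (D : VectorMeasure Plane Plane) :
    IsFiniteMeasure D.variation := by
  obtain ⟨ν, k, hν, hk, rfl⟩ := exists_eq_withDensityᵥ D
  rw [Measure.variation_withDensityᵥ hk]
  exact isFiniteMeasure_withDensity hk.2.ne

/-- Integration against the vector measure with density `k`. -/
theorem integral_withDensityᵥ {ν : Measure Plane} {k : Plane → Plane} (hk : Integrable k ν)
    {φ : Plane → ℝ} (hφ : Integrable φ (ν.withDensityᵥ k).variation) :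
    ∫ᵛ x, φ x ∂•(ν.withDensityᵥ k) = ∫ x, φ x • k x ∂ν := by
  have hvar := Measure.variation_withDensityᵥ hk
  have hfin : IsFiniteMeasure (ν.withDensityᵥ k).variation := isFiniteMeasure_variation _
  have hae : ∀ {f g : Plane → ℝ}, f =ᵐ[(ν.withDensityᵥ k).variation] g →
      (fun x => f x • k x) =ᵐ[ν] fun x => g x • k x := by
    intro f g h
    rw [hvar, Filter.EventuallyEq, ae_withDensity_iff' hk.1.enorm] at h
    filter_upwards [h] with x hx
    by_cases h0 : k x = 0
    · simp [h0]
    · rw [hx (by simpa using h0)]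
  -- The map `f ↦ f • k` is an isometry from `L¹` of the variation into `L¹(ν)`. Both sides are
  -- therefore continuous in the integrand, and indicators suffice.
  have key : ∀ f : Plane → ℝ, Integrable f (ν.withDensityᵥ k).variation →
      ∫⁻ x, ‖f x • k x‖ₑ ∂ν = ∫⁻ x, ‖f x‖ₑ ∂(ν.withDensityᵥ k).variation ∧
      AEStronglyMeasurable (fun x => f x • k x) ν := by
    intro f hf
    obtain ⟨g, hg, hfg⟩ := hf.1
    have hs := hae hfg
    constructor
    · calc ∫⁻ x, ‖f x • k x‖ₑ ∂ν = ∫⁻ x, ‖g x • k x‖ₑ ∂ν :=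
            lintegral_congr_ae (hs.mono fun x hx => by simp only [hx])
        _ = ∫⁻ x, ‖g x‖ₑ ∂(ν.withDensityᵥ k).variation := by
            rw [hvar, lintegral_withDensity_eq_lintegral_mul₀ hk.1.enorm hg.measurable.enorm.aemeasurable]
            simp [enorm_smul, mul_comm]
        _ = _ := lintegral_congr_ae (hfg.mono fun x hx => by simp only [hx])
    · exact (hg.aestronglyMeasurable.smul hk.1).congr hs.symm
  have hint : ∀ f : Plane → ℝ, Integrable f (ν.withDensityᵥ k).variation →
      Integrable (fun x => f x • k x) ν := fun f hf =>
    ⟨(key f hf).2, by rw [HasFiniteIntegral, (key f hf).1]; exact hf.2⟩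
  revert φ
  refine Integrable.induction _ ?_ ?_ ?_ ?_
  · intro c s hs hlt
    have : (fun x => s.indicator (fun _ => c) x • k x) = s.indicator fun x => c • k x := by
      ext1 x
      by_cases hx : x ∈ s <;> simp [hx]
    rw [VectorMeasure.integral_indicator hs, this, MeasureTheory.integral_indicator hs,
      integral_smul, VectorMeasure.integral_const, VectorMeasure.restrict_apply _ hs .univ,
      univ_inter, withDensityᵥ_apply hk hs]
    simp
  · intro f g _ hf hg ihf ihg
    rw [VectorMeasure.integral_add hf hg, ihf, ihg, ← MeasureTheory.integral_add (hint _ hf) (hint _ hg)]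
    simp [add_smul]
  · refine isClosed_eq (VectorMeasure.continuous_integral) ?_
    rw [continuous_iff_continuousAt]
    intro f
    refine tendsto_integral_of_L1 _ (hint _ (L1.integrable_coeFn f)).1
      (Eventually.of_forall fun g => hint _ (L1.integrable_coeFn g)) ?_
    have h1 : ∀ g : Plane →₁[(ν.withDensityᵥ k).variation] ℝ,
        ∫⁻ x, ‖g x • k x - f x • k x‖ₑ ∂ν = edist g f := by
      intro g
      simp_rw [← sub_smul]
      rw [(key (fun x => g x - f x) ((L1.integrable_coeFn g).sub (L1.integrable_coeFn f))).1,
        L1.edist_def]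
      simp [edist_eq_enorm_sub]
    simp_rw [h1]
    exact (tendsto_iff_edist_tendsto_0 (f := id)).1 tendsto_id
  · intro f g hfg hf ih
    rw [← VectorMeasure.integral_congr_ae hfg, ih]
    exact MeasureTheory.integral_congr_ae (hae hfg)

theorem integrable_of_smooth {φ : Plane → ℝ} (hφ : ContDiff ℝ ∞ φ) (hc : HasCompactSupport φ)
    (μ : Measure Plane) [IsFiniteMeasure μ] : Integrable φ μ :=
  hφ.continuous.integrable_of_hasCompactSupport hc

/-- A plane-valued vector measure is determined by the integrals of test functions. -/
theorem eq_zero_of_integral_smooth_eq_zero (D : VectorMeasure Plane Plane)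
    (h : ∀ φ : Plane → ℝ, ContDiff ℝ ∞ φ → HasCompactSupport φ → ∫ᵛ x, φ x ∂•D = 0) : D = 0 := by
  obtain ⟨ν, k, hν, hk, rfl⟩ := exists_eq_withDensityᵥ D
  have hfin := isFiniteMeasure_variation (ν.withDensityᵥ k)
  have h0 : ∀ᵐ x ∂ν, k x = 0 := by
    refine ae_eq_zero_of_integral_contDiff_smul_eq_zero hk.locallyIntegrable fun φ hφ hc => ?_
    rw [← integral_withDensityᵥ hk (integrable_of_smooth hφ hc _)]
    exact h φ hφ hc
  rw [WithDensityᵥEq.congr_ae (g := 0) h0, withDensityᵥ_zero]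

theorem IsDistribGradient.unique {u : Plane → ℝ} {D D' : VectorMeasure Plane Plane}
    (h : IsDistribGradient u D) (h' : IsDistribGradient u D') : D = D' := by
  rw [← sub_eq_zero]
  refine eq_zero_of_integral_smooth_eq_zero _ fun φ hφ hc => ?_
  have := isFiniteMeasure_variation D
  have := isFiniteMeasure_variation D'
  rw [VectorMeasure.integral_sub_vectorMeasure (integrable_of_smooth hφ hc _)
    (integrable_of_smooth hφ hc _), sub_eq_zero]
  exact neg_injective ((h φ hφ hc).symm.trans (h' φ hφ hc))

/-- `distribGradient` is a choice among representing measures; uniqueness lets any explicit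
representative replace it. -/
theorem IsDistribGradient.distribGradient_eq {u : Plane → ℝ} {D : VectorMeasure Plane Plane}
    (h : IsDistribGradient u D) : distribGradient u = D := by
  have : ∃ μ, IsDistribGradient u μ := ⟨D, h⟩
  rw [distribGradient, dif_pos this]
  exact this.choose_spec.unique h

end PlanarSteiner

/-! ### Riesz representation of functionals dominated by a finite measure. -/

namespace PlanarSteiner

/-- The smooth compactly supported vector fields of the plane. -/
def testFields : Submodule ℝ (Plane → Plane) where
  carrier := {w | ContDiff ℝ ∞ w ∧ HasCompactSupport w}
  add_mem' h h' := ⟨h.1.add h'.1, h.2.add h'.2⟩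
  zero_mem' := ⟨contDiff_const, HasCompactSupport.zero⟩
  smul_mem' c _ h := ⟨contDiff_const.smul h.1, h.2.smul_left (f := fun _ => c)⟩

section Riesz

variable {κ : Measure Plane} [IsFiniteMeasure κ]

theorem testFields_memLp (w : testFields) (p : ℝ≥0∞) : MemLp (w : Plane → Plane) p κ :=
  w.2.1.continuous.memLp_of_hasCompactSupport w.2.2

/-- The class of a test field in `L²(κ)`. -/
def testFieldsToLp (κ : Measure Plane) [IsFiniteMeasure κ] : testFields →ₗ[ℝ] Lp Plane 2 κ where
  toFun w := (testFields_memLp w 2).toLp _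
  map_add' _ _ := rfl
  map_smul' _ _ := rfl

theorem testFieldsToLp_coe (w : testFields) : testFieldsToLp κ w =ᵐ[κ] (w : Plane → Plane) :=
  MemLp.coeFn_toLp (testFields_memLp w 2)

/-- Hölder on a finite measure space. A functional dominated in `L¹(κ)` thereby becomes bounded in
`L²(κ)`, where the Hilbert space Riesz theorem is available. -/
theorem integral_norm_le_L2 (f : Lp Plane 2 κ) :
    ∫ x, ‖f x‖ ∂κ ≤ (κ univ ^ (1 / 2 : ℝ)).toReal * ‖f‖ := by
  have h := eLpNorm_le_eLpNorm_mul_rpow_measure_univ (p := 1) (q := 2) (by norm_num)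
    (Lp.aestronglyMeasurable f)
  rw [integral_norm_eq_lintegral_enorm (Lp.aestronglyMeasurable f), ← eLpNorm_one_eq_lintegral_enorm,
    Lp.norm_def, mul_comm, ← ENNReal.toReal_mul]
  refine ENNReal.toReal_mono (ENNReal.mul_ne_top (Lp.eLpNorm_ne_top f)
    (ENNReal.rpow_ne_top_of_nonneg (by norm_num) (measure_ne_top _ _))) ?_
  convert h using 3
  norm_num

theorem continuous_integral_norm_L2 : Continuous fun f : Lp Plane 2 κ => ∫ x, ‖f x‖ ∂κ := by
  refine LipschitzWith.continuous (K := (κ univ ^ (1 / 2 : ℝ)).toNNReal) ?_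
  refine LipschitzWith.of_dist_le_mul fun f g => ?_
  have hf : ∀ h : Lp Plane 2 κ, Integrable (fun x => ‖h x‖) κ := fun h =>
    ((Lp.memLp h).integrable (by norm_num)).norm
  rw [dist_eq_norm, dist_eq_norm, ← integral_sub (hf f) (hf g)]
  refine le_trans ?_ (integral_norm_le_L2 (f - g))
  refine norm_integral_le_of_norm_le (hf (f - g)) ?_
  filter_upwards [Lp.coeFn_sub f g] with x hx
  rw [hx]
  exact abs_norm_sub_norm_le _ _

/-- A class `g` orthogonal to all test fields is orthogonal to `φ • v` with `v = ∫ φ • g dκ`, which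
forces `v = 0` for every scalar test function `φ`. -/
theorem denseRange_testFieldsToLp : Dense (LinearMap.range (testFieldsToLp κ) : Set (Lp Plane 2 κ)) := by
  rw [Submodule.dense_iff_topologicalClosure_eq_top, Submodule.topologicalClosure_eq_top_iff,
    Submodule.eq_bot_iff]
  intro g hg
  have hgi : Integrable g κ := (Lp.memLp g).integrable (by norm_num)
  have h0 : ∀ᵐ x ∂κ, g x = 0 := by
    refine ae_eq_zero_of_integral_contDiff_smul_eq_zero hgi.locallyIntegrable fun φ hφ hc => ?_
    obtain ⟨C, hC⟩ := hφ.continuous.bounded_above_of_compact_support hc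
    have hi : Integrable (fun x => φ x • g x) κ :=
      hgi.bdd_smul C hφ.continuous.aestronglyMeasurable (Eventually.of_forall hC)
    rw [← inner_self_eq_zero (𝕜 := ℝ)]
    set v := ∫ x, φ x • g x ∂κ
    have hw : (fun x => φ x • v) ∈ testFields :=
      ⟨hφ.smul contDiff_const, hc.smul_right⟩
    have h1 := (Submodule.mem_orthogonal' _ g).1 hg _ ⟨⟨_, hw⟩, rfl⟩
    rw [L2.inner_def] at h1
    rw [← integral_inner hi v, ← h1]
    refine integral_congr_ae ?_
    filter_upwards [testFieldsToLp_coe (κ := κ) ⟨_, hw⟩] with x hx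
    rw [hx, real_inner_smul_right, real_inner_smul_right, real_inner_comm]
  exact (Lp.eq_zero_iff_ae_eq_zero).2 h0

/-- A linear functional on test fields that is dominated by a finite measure is given by a vector
measure whose variation is at most that measure. -/
theorem exists_density_of_abs_le (S : testFields →ₗ[ℝ] ℝ)
    (hS : ∀ w : testFields, |S w| ≤ ∫ x, ‖(w : Plane → Plane) x‖ ∂κ) :
    ∃ k : Plane → Plane, Integrable k κ ∧ (κ.withDensityᵥ k).variation ≤ κ ∧
      ∀ w : testFields, ∫ x, inner ℝ (k x) ((w : Plane → Plane) x) ∂κ = S w := by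
  have hN : ∀ w : testFields, |S w| ≤ ∫ x, ‖testFieldsToLp κ w x‖ ∂κ := by
    intro w
    refine (hS w).trans_eq (integral_congr_ae ?_)
    filter_upwards [testFieldsToLp_coe (κ := κ) w] with x hx
    rw [hx]
  -- The domination makes `S` vanish on fields that are zero `κ`-almost everywhere, so `S` factors
  -- through classes in `L²(κ)`.
  obtain ⟨g, hg⟩ : S ∈ LinearMap.range (testFieldsToLp κ).dualMap := by
    rw [LinearMap.range_dualMap_eq_dualAnnihilator_ker, Submodule.mem_dualAnnihilator]
    intro w hw
    rw [LinearMap.mem_ker] at hw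
    have := (hN w).trans (integral_norm_le_L2 _)
    rw [hw, norm_zero, mul_zero] at this
    exact abs_nonpos_iff.1 this
  have hg' : ∀ w, g (testFieldsToLp κ w) = S w := fun w => by rw [← hg]; rfl
  let V := LinearMap.range (testFieldsToLp κ)
  let f : StrongDual ℝ V := (g.comp V.subtype).mkContinuous ((κ univ ^ (1 / 2 : ℝ)).toReal) (by
    rintro ⟨_, w, rfl⟩
    simp only [LinearMap.comp_apply, Submodule.subtype_apply, hg', Real.norm_eq_abs]
    exact (hN w).trans (integral_norm_le_L2 _))
  obtain ⟨G, hG, -⟩ := exists_extension_norm_eq V f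
  let k := (InnerProductSpace.toDual ℝ (Lp Plane 2 κ)).symm G
  have hkS : ∀ w, inner ℝ k (testFieldsToLp κ w) = S w := by
    intro w
    rw [InnerProductSpace.toDual_symm_apply, hG ⟨_, w, rfl⟩, ← hg']
    rfl
  have hle : ∀ h : Lp Plane 2 κ, inner ℝ k h ≤ ∫ x, ‖h x‖ ∂κ := by
    intro h
    refine denseRange_testFieldsToLp.induction (P := fun h => inner ℝ k h ≤ ∫ x, ‖h x‖ ∂κ) ?_
      (isClosed_le (by fun_prop) continuous_integral_norm_L2) h
    rintro _ ⟨w, rfl⟩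
    rw [hkS]
    exact (le_abs_self _).trans (hN w)
  have hki : Integrable k κ := (Lp.memLp k).integrable (by norm_num)
  refine ⟨k, hki, VectorMeasure.variation_le_of_forall_enorm_le fun A hA => ?_, fun w => ?_⟩
  · rw [withDensityᵥ_apply hki hA]
    -- Testing with the constant `v` on `A` turns the `L¹` inequality into `‖v‖² ≤ κ(A) ‖v‖`; this
    -- is how the sharp variation bound is recovered from an `L²` argument.
    set v := ∫ x in A, k x ∂κ
    have h1 := hle (indicatorConstLp 2 hA (measure_ne_top κ A) v)
    have h2 : inner ℝ k (indicatorConstLp 2 hA (measure_ne_top κ A) v) = ‖v‖ * ‖v‖ := by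
      rw [real_inner_comm, L2.inner_indicatorConstLp_eq_setIntegral_inner, integral_inner hki.integrableOn v,
        real_inner_self_eq_norm_mul_norm]
    have h3 : ∫ x, ‖(indicatorConstLp 2 hA (measure_ne_top κ A) v : Plane → Plane) x‖ ∂κ =
        κ.real A * ‖v‖ := by
      rw [integral_congr_ae (g := A.indicator fun _ => ‖v‖), integral_indicator hA]
      · simp
      · filter_upwards [indicatorConstLp_coeFn (p := 2) (hs := hA) (hμs := measure_ne_top κ A) (c := v)]
          with x hx
        rw [hx]
        by_cases hxA : x ∈ A <;> simp [hxA]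
    rw [h2, h3] at h1
    have h4 : ‖v‖ ≤ κ.real A := by
      rcases (norm_nonneg v).eq_or_lt with h | h
      · rw [← h]; exact measureReal_nonneg
      · exact le_of_mul_le_mul_right h1 h
    rw [← ofReal_norm, ← ofReal_measureReal]
    exact ENNReal.ofReal_le_ofReal h4
  · rw [← hkS, L2.inner_def]
    refine integral_congr_ae ?_
    filter_upwards [testFieldsToLp_coe (κ := κ) w] with x hx
    rw [hx]

end Riesz

/-- The scalar curl `∂₀ w₁ - ∂₁ w₀` of a vector field in the plane. -/
def curl (w : Plane → Plane) (x : Plane) : ℝ :=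
  fderiv ℝ w x (EuclideanSpace.single 0 1) 1 - fderiv ℝ w x (EuclideanSpace.single 1 1) 0

/-- The functional `Du^⊥ - τ λ` is dominated by the positive measure `κ`. -/
def CurlDominated (u : Plane → ℝ) (l : Measure Plane) (τ : Plane) (κ : Measure Plane) : Prop :=
  ∀ w : Plane → Plane, ContDiff ℝ ∞ w → HasCompactSupport w →
    |(∫ x, u x * curl w x) + ∫ x, inner ℝ τ (w x) ∂l| ≤ ∫ x, ‖w x‖ ∂κ

end PlanarSteiner

/-! ### Equivalence of the variation bound with its dual form on test fields. -/

namespace PlanarSteiner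

theorem integrable_mul_of_continuous_hasCompactSupport {u f : Plane → ℝ} {μ : Measure Plane}
    (hu : Integrable u μ) (hf : Continuous f) (hc : HasCompactSupport f) :
    Integrable (fun x => u x * f x) μ := by
  obtain ⟨C, hC⟩ := hf.bounded_above_of_compact_support hc
  exact hu.mul_bdd (c := C) hf.aestronglyMeasurable (Eventually.of_forall hC)

theorem gradient_apply {φ : Plane → ℝ} (x : Plane) (j : Fin 2) :
    gradient φ x j = fderiv ℝ φ x (EuclideanSpace.single j 1) := by
  rw [gradient, ← InnerProductSpace.toDual_symm_apply (𝕜 := ℝ), EuclideanSpace.inner_single_right]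
  simp

theorem continuous_fderiv_apply_of_smooth {E : Type*} [NormedAddCommGroup E] [NormedSpace ℝ E]
    {φ : Plane → E} (hφ : ContDiff ℝ ∞ φ) (v : Plane) : Continuous fun x => fderiv ℝ φ x v :=
  (hφ.continuous_fderiv (by simp)).clm_apply continuous_const

theorem continuous_gradient {φ : Plane → ℝ} (hφ : ContDiff ℝ ∞ φ) : Continuous (gradient φ) :=
  (InnerProductSpace.toDual ℝ Plane).symm.continuous.comp (hφ.continuous_fderiv (by simp))

theorem hasCompactSupport_gradient {φ : Plane → ℝ} (hc : HasCompactSupport φ) :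
    HasCompactSupport (gradient φ) :=
  (hc.fderiv ℝ).comp_left (g := (InnerProductSpace.toDual ℝ Plane).symm) (map_zero _)

theorem integrable_smul_gradient {u φ : Plane → ℝ} (hu : Integrable u) (hφ : ContDiff ℝ ∞ φ)
    (hc : HasCompactSupport φ) : Integrable fun x => u x • gradient φ x := by
  obtain ⟨C, hC⟩ := (continuous_gradient hφ).bounded_above_of_compact_support
    (hasCompactSupport_gradient hc)
  exact hu.smul_bdd C (continuous_gradient hφ).aestronglyMeasurable (Eventually.of_forall hC)

theorem integral_smul_gradient_apply {u φ : Plane → ℝ} (hu : Integrable u) (hφ : ContDiff ℝ ∞ φ)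
    (hc : HasCompactSupport φ) (j : Fin 2) :
    (∫ x, u x • gradient φ x) j = ∫ x, u x * fderiv ℝ φ x (EuclideanSpace.single j 1) := by
  have h := (EuclideanSpace.proj j : Plane →L[ℝ] ℝ).integral_comp_comm
    (integrable_smul_gradient hu hφ hc)
  refine Eq.trans h.symm ?_
  simp [gradient_apply]

theorem fderiv_apply_coord {w : Plane → Plane} (hw : ContDiff ℝ ∞ w) (x v : Plane) (j : Fin 2) :
    fderiv ℝ w x v j = fderiv ℝ (fun y => w y j) x v := by
  have h := ((EuclideanSpace.proj j : Plane →L[ℝ] ℝ).hasFDerivAt.comp x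
    (hw.differentiable (by simp) x).hasFDerivAt).fderiv
  have h' : (EuclideanSpace.proj j : Plane →L[ℝ] ℝ) ∘ w = fun y => w y j := rfl
  rw [← h', h]
  rfl

theorem contDiff_coord {w : Plane → Plane} (hw : ContDiff ℝ ∞ w) (j : Fin 2) :
    ContDiff ℝ ∞ fun y => w y j :=
  (EuclideanSpace.proj j : Plane →L[ℝ] ℝ).contDiff.comp hw

theorem hasCompactSupport_coord {w : Plane → Plane} (hw : HasCompactSupport w) (j : Fin 2) :
    HasCompactSupport fun y => w y j :=
  hw.comp_left (g := fun v : Plane => v j) rfl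

theorem curl_eq {w : Plane → Plane} (hw : ContDiff ℝ ∞ w) (x : Plane) :
    curl w x = fderiv ℝ (fun y => w y 1) x (EuclideanSpace.single 0 1) -
      fderiv ℝ (fun y => w y 0) x (EuclideanSpace.single 1 1) := by
  rw [curl, fderiv_apply_coord hw, fderiv_apply_coord hw]

theorem perp_perp (v : Plane) : perp (perp v) = -v := by
  ext j
  fin_cases j <;> simp [perp_apply]

theorem norm_perp (v : Plane) : ‖perp v‖ = ‖v‖ := by
  rw [EuclideanSpace.norm_eq, EuclideanSpace.norm_eq]
  simp [perp_apply, Fin.sum_univ_two, add_comm]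

theorem mapRange_clm_apply (V : VectorMeasure Plane Plane) (A : Plane →L[ℝ] Plane) (s : Set Plane) :
    V.mapRange (A : Plane →+ Plane) A.continuous s = A (V s) := rfl

theorem integral_mapRange {V : VectorMeasure Plane Plane} (A : Plane →L[ℝ] Plane) {φ : Plane → ℝ}
    (hφ : ContDiff ℝ ∞ φ) (hc : HasCompactSupport φ) :
    ∫ᵛ x, φ x ∂•(V.mapRange (A : Plane →+ Plane) A.continuous) = A (∫ᵛ x, φ x ∂•V) := by
  obtain ⟨ν, k, hν, hk, rfl⟩ := exists_eq_withDensityᵥ V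
  have h1 : (ν.withDensityᵥ k).mapRange (A : Plane →+ Plane) A.continuous =
      ν.withDensityᵥ fun x => A (k x) := by
    ext1 s hs
    rw [withDensityᵥ_apply (A.integrable_comp hk) hs, mapRange_clm_apply,
      withDensityᵥ_apply hk hs]
    exact (A.integral_comp_comm hk.integrableOn).symm
  have := isFiniteMeasure_variation (ν.withDensityᵥ k)
  have := isFiniteMeasure_variation (ν.withDensityᵥ fun x => A (k x))
  have hi : Integrable (fun x => φ x • k x) ν := by
    obtain ⟨C, hC⟩ := hφ.continuous.bounded_above_of_compact_support hc
    exact hk.bdd_smul C hφ.continuous.aestronglyMeasurable (Eventually.of_forall hC)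
  rw [h1, integral_withDensityᵥ (A.integrable_comp hk) (integrable_of_smooth hφ hc _),
    integral_withDensityᵥ hk (integrable_of_smooth hφ hc _), ← A.integral_comp_comm hi]
  simp

variable {u : Plane → ℝ} {l κ : Measure Plane} {τ : Plane}

/-- Passing from the scalar to the vectorial form of the integration by parts formula. -/
theorem integral_inner_eq {ν : Measure Plane} {k : Plane → Plane} [IsFiniteMeasure l]
    (hu : Integrable u) (hk : Integrable k ν)
    (h : ∀ φ : Plane → ℝ, ContDiff ℝ ∞ φ → HasCompactSupport φ →
      ∫ x, φ x • k x ∂ν = -perp (∫ x, u x • gradient φ x) - (∫ x, φ x ∂l) • τ)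
    {w : Plane → Plane} (hw : ContDiff ℝ ∞ w) (hc : HasCompactSupport w) :
    ∫ x, inner ℝ (k x) (w x) ∂ν = -((∫ x, u x * curl w x) + ∫ x, inner ℝ τ (w x) ∂l) := by
  have hcw := fun j => contDiff_coord hw j
  have hcc := fun j => hasCompactSupport_coord hc j
  have hki : ∀ j, Integrable (fun x => w x j • k x) ν := fun j => by
    obtain ⟨C, hC⟩ := (hcw j).continuous.bounded_above_of_compact_support (hcc j)
    exact hk.bdd_smul C (hcw j).continuous.aestronglyMeasurable (Eventually.of_forall hC)
  have hkj : ∀ j, ∫ x, w x j * k x j ∂ν = (∫ x, w x j • k x ∂ν) j := fun j => by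
    have := (EuclideanSpace.proj j : Plane →L[ℝ] ℝ).integral_comp_comm (hki j)
    refine Eq.trans ?_ this
    simp
  have hkij : ∀ j, Integrable (fun x => w x j * k x j) ν := fun j => by
    have := (EuclideanSpace.proj j : Plane →L[ℝ] ℝ).integrable_comp (hki j)
    simpa using this
  have huf : ∀ i j : Fin 2, Integrable fun x =>
      u x * fderiv ℝ (fun y => w y i) x (EuclideanSpace.single j 1) := fun i j =>
    integrable_mul_of_continuous_hasCompactSupport hu
      (continuous_fderiv_apply_of_smooth (hcw i) _) ((hcc i).fderiv_apply ℝ _)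
  have hl : ∀ j, Integrable (fun x => w x j) l := fun j => integrable_of_smooth (hcw j) (hcc j) l
  have e1 : ∫ x, inner ℝ (k x) (w x) ∂ν = (∫ x, w x 0 * k x 0 ∂ν) + ∫ x, w x 1 * k x 1 ∂ν := by
    rw [← integral_add (hkij 0) (hkij 1)]
    simp [PiLp.inner_apply, Fin.sum_univ_two]
  have e2 : ∫ x, inner ℝ τ (w x) ∂l = (∫ x, w x 0 ∂l) * τ 0 + (∫ x, w x 1 ∂l) * τ 1 := by
    rw [← integral_mul_const, ← integral_mul_const,
      ← integral_add ((hl 0).mul_const _) ((hl 1).mul_const _)]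
    simp [PiLp.inner_apply, Fin.sum_univ_two]
  have e3 : ∫ x, u x * curl w x =
      (∫ x, u x * fderiv ℝ (fun y => w y 1) x (EuclideanSpace.single 0 1)) -
      ∫ x, u x * fderiv ℝ (fun y => w y 0) x (EuclideanSpace.single 1 1) := by
    rw [← integral_sub (huf 1 0) (huf 0 1)]
    simp_rw [curl_eq hw, mul_sub]
  rw [e1, e2, e3, hkj, hkj, h _ (hcw 0) (hcc 0), h _ (hcw 1) (hcc 1)]
  have g1 := integral_smul_gradient_apply hu (hcw 0) (hcc 0) 1
  have g2 := integral_smul_gradient_apply hu (hcw 1) (hcc 1) 0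
  simp only [perp_apply, PiLp.sub_apply, PiLp.neg_apply, PiLp.smul_apply, smul_eq_mul,
    Matrix.cons_val_zero, Matrix.cons_val_one]
  rw [g1, g2]
  ring

/-- If the difference of measures has density `k` with respect to `ν`, the pairing is `-∫ ⟨k, w⟩
dν`. Cauchy–Schwarz bounds it by the integral of `|w|` against `|k| ν`, which is the variation. -/
theorem curlDominated_of_variation_le [IsFiniteMeasure l] [IsFiniteMeasure κ] (hu : MemBV u)
    (h : (orthGradient u - l.withDensityᵥ fun _ => τ).variation ≤ κ) : CurlDominated u l τ κ := by
  obtain ⟨ν, k, hν, hk, hT⟩ := exists_eq_withDensityᵥ (orthGradient u - l.withDensityᵥ fun _ => τ)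
  have hf1 := isFiniteMeasure_variation (orthGradient u)
  have hf2 := isFiniteMeasure_variation (l.withDensityᵥ fun _ => τ)
  have hf3 := isFiniteMeasure_variation (ν.withDensityᵥ k)
  intro w hw hc
  have h1 := integral_inner_eq (l := l) (τ := τ) hu.integrable hk (fun φ hφ hcφ => by
    rw [← integral_withDensityᵥ hk (integrable_of_smooth hφ hcφ _), ← hT,
      VectorMeasure.integral_sub_vectorMeasure (integrable_of_smooth hφ hcφ _)
        (integrable_of_smooth hφ hcφ _),
      integral_withDensityᵥ (integrable_const τ) (integrable_of_smooth hφ hcφ _),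
      integral_smul_const, orthGradient, integral_mapRange _ hφ hcφ,
      hu.isDistribGradient φ hφ hcφ, map_neg, neg_neg]) hw hc
  rw [← abs_neg, ← h1]
  rw [hT, Measure.variation_withDensityᵥ hk] at h
  have hwi : Integrable (fun x => ‖w x‖) κ :=
    (hw.continuous.integrable_of_hasCompactSupport hc).norm
  calc |∫ x, inner ℝ (k x) (w x) ∂ν| ≤ ∫ x, ‖w x‖ ∂(ν.withDensity fun x => ‖k x‖ₑ) := by
        have e : ∫ x, ‖w x‖ ∂(ν.withDensity fun x => ‖k x‖ₑ) = ∫ x, ‖k x‖ * ‖w x‖ ∂ν := by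
          rw [integral_withDensity_eq_integral_toReal_smul₀ hk.1.enorm (by simp)]
          simp
        rw [e]
        refine norm_integral_le_of_norm_le (f := fun x => inner ℝ (k x) (w x)) ?_
          (Eventually.of_forall fun x => ?_)
        · obtain ⟨C, hC⟩ := hw.continuous.bounded_above_of_compact_support hc
          exact hk.norm.mul_bdd (c := C) hw.continuous.norm.aestronglyMeasurable
            (Eventually.of_forall fun x => by simpa using hC x)
        · exact norm_inner_le_norm _ _
    _ ≤ ∫ x, ‖w x‖ ∂κ := integral_mono_measure h (Eventually.of_forall fun x => norm_nonneg _) hwi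

theorem fderiv_smul_const_apply {φ : Plane → ℝ} (hφ : ContDiff ℝ ∞ φ) (a x v : Plane) :
    fderiv ℝ (fun y => φ y • a) x v = fderiv ℝ φ x v • a := by
  rw [fderiv_smul_const (hφ.differentiable (by simp) x)]
  rfl

theorem curl_smul_const {φ : Plane → ℝ} (hφ : ContDiff ℝ ∞ φ) (a x : Plane) :
    curl (fun y => φ y • a) x = inner ℝ (perp (gradient φ x)) a := by
  rw [curl, fderiv_smul_const_apply hφ, fderiv_smul_const_apply hφ]
  simp [PiLp.inner_apply, perp_apply, Fin.sum_univ_two, gradient_apply]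
  ring_nf

theorem integrable_mul_curl (hu : Integrable u) {w : Plane → Plane} (hw : ContDiff ℝ ∞ w)
    (hc : HasCompactSupport w) : Integrable fun x => u x * curl w x := by
  simp_rw [curl_eq hw, mul_sub]
  refine Integrable.sub ?_ ?_ <;>
  exact integrable_mul_of_continuous_hasCompactSupport hu
      (continuous_fderiv_apply_of_smooth (contDiff_coord hw _) _)
      ((hasCompactSupport_coord hc _).fderiv_apply ℝ _)

theorem curl_add {w w' : Plane → Plane} (hw : ContDiff ℝ ∞ w) (hw' : ContDiff ℝ ∞ w') (x : Plane) :
    curl (w + w') x = curl w x + curl w' x := by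
  simp only [curl, fderiv_add (hw.differentiable (by simp) x) (hw'.differentiable (by simp) x)]
  simp
  ring

theorem curl_const_smul {w : Plane → Plane} (hw : ContDiff ℝ ∞ w) (c : ℝ) (x : Plane) :
    curl (c • w) x = c * curl w x := by
  simp only [curl, fderiv_const_smul (hw.differentiable (by simp) x)]
  simp
  ring

/-- The functional `Du^⊥ - τ l` on test fields. -/
def curlFunctional (u : Plane → ℝ) (hu : Integrable u) (l : Measure Plane) [IsFiniteMeasure l]
    (τ : Plane) : testFields →ₗ[ℝ] ℝ where
  toFun w := -((∫ x, u x * curl w x) + ∫ x, inner ℝ τ ((w : Plane → Plane) x) ∂l)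
  map_add' w w' := by
    have h : ∀ w : testFields, Integrable (fun x => inner ℝ τ ((w : Plane → Plane) x)) l := fun w =>
      ((testFields_memLp w 1).integrable le_rfl).const_inner τ
    simp only [Submodule.coe_add, Pi.add_apply, curl_add w.2.1 w'.2.1, mul_add, inner_add_right]
    rw [integral_add (integrable_mul_curl hu w.2.1 w.2.2) (integrable_mul_curl hu w'.2.1 w'.2.2),
      integral_add (h w) (h w')]
    ring
  map_smul' c w := by
    simp only [Submodule.coe_smul, Pi.smul_apply, curl_const_smul w.2.1, real_inner_smul_right]
    rw [integral_const_mul, RingHom.id_apply, smul_eq_mul, mul_neg, mul_add, ← integral_const_mul,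
      ← integral_const_mul]
    congr 3
    ext x
    ring

/-- Riesz gives a measure `T` of variation at most `κ` that acts as `Du^⊥ - τ l`. As the rotation
squares to `-1`, `-perp (T + Γ)` is a gradient of `u`. Thus membership in BV is a consequence, as
required for limits of competitors. -/
theorem variation_le_of_curlDominated [IsFiniteMeasure l] [IsFiniteMeasure κ] (hu : Integrable u)
    (h : CurlDominated u l τ κ) :
    MemBV u ∧ (orthGradient u - l.withDensityᵥ fun _ => τ).variation ≤ κ := by
  obtain ⟨k, hk, hvar, hS⟩ := exists_density_of_abs_le (κ := κ) (curlFunctional u hu l τ)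
    (fun w => by
      rw [curlFunctional]
      simp only [LinearMap.coe_mk, AddHom.coe_mk, abs_neg]
      exact h w w.2.1 w.2.2)
  set T := κ.withDensityᵥ k
  set Γ := l.withDensityᵥ fun _ => τ
  have := isFiniteMeasure_variation T
  have := isFiniteMeasure_variation Γ
  let A : Plane →L[ℝ] Plane := -perp
  have hD : IsDistribGradient u ((T + Γ).mapRange (A : Plane →+ Plane) A.continuous) := by
    intro φ hφ hc
    have hi : Integrable (fun x => φ x • k x) κ := by
      obtain ⟨C, hC⟩ := hφ.continuous.bounded_above_of_compact_support hc
      exact hk.bdd_smul C hφ.continuous.aestronglyMeasurable (Eventually.of_forall hC)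
    have key : (∫ x, φ x • k x ∂κ) + (∫ x, φ x ∂l) • τ = -perp (∫ x, u x • gradient φ x) := by
      refine ext_inner_right ℝ fun a => ?_
      have h1 := hS ⟨fun x => φ x • a, hφ.smul contDiff_const, hc.smul_right⟩
      simp only [curlFunctional, LinearMap.coe_mk, AddHom.coe_mk, curl_smul_const hφ,
        real_inner_smul_right] at h1
      rw [inner_add_left, inner_neg_left, real_inner_smul_left]
      have h2 : inner ℝ (∫ x, φ x • k x ∂κ) a = ∫ x, φ x * inner ℝ (k x) a ∂κ := by
        rw [real_inner_comm, ← integral_inner hi a]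
        refine integral_congr_ae (Eventually.of_forall fun x => ?_)
        simp only [real_inner_smul_right]
        rw [real_inner_comm]
      have h3 : inner ℝ (perp (∫ x, u x • gradient φ x)) a =
          ∫ x, u x * inner ℝ (perp (gradient φ x)) a := by
        rw [← perp.integral_comp_comm (integrable_smul_gradient hu hφ hc), real_inner_comm,
          ← integral_inner (perp.integrable_comp (integrable_smul_gradient hu hφ hc)) a]
        refine integral_congr_ae (Eventually.of_forall fun x => ?_)
        simp only [map_smul, real_inner_smul_right]
        rw [real_inner_comm]
      rw [h2, h3, h1, ← integral_mul_const]
      ring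
    rw [integral_mapRange _ hφ hc, VectorMeasure.integral_add_vectorMeasure
      (integrable_of_smooth hφ hc _) (integrable_of_smooth hφ hc _),
      integral_withDensityᵥ hk (integrable_of_smooth hφ hc _),
      integral_withDensityᵥ (integrable_const τ) (integrable_of_smooth hφ hc _),
      integral_smul_const, key]
    simp [A, perp_perp]
  refine ⟨⟨hu, _, hD⟩, ?_⟩
  have : orthGradient u - Γ = T := by
    rw [orthGradient, hD.distribGradient_eq]
    ext1 s hs
    rw [sub_apply, mapRange_clm_apply, mapRange_clm_apply]
    simp [A, perp_perp]
  rwa [this]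

end PlanarSteiner

/-! ### Mollification, the Sobolev inequality and translation estimates in `L¹`. -/

namespace PlanarSteiner

/-- The distributional gradient of `u` is dominated by the positive measure `ν`. -/
def GradBound (u : Plane → ℝ) (ν : Measure Plane) : Prop :=
  ∀ φ : Plane → ℝ, ContDiff ℝ ∞ φ → HasCompactSupport φ → ∀ v : Plane,
    |∫ x, u x * fderiv ℝ φ x v| ≤ ‖v‖ * ∫ x, |φ x| ∂ν

/-- Testing with `φ • perp v` works because its curl is the derivative of `φ` along `v`; the segment
term costs at most `l`. -/
theorem CurlDominated.gradBound {u : Plane → ℝ} {l κ : Measure Plane} {τ : Plane}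
    [IsFiniteMeasure l] [IsFiniteMeasure κ] (h : CurlDominated u l τ κ) (hτ : ‖τ‖ ≤ 1) :
    GradBound u (κ + l) := by
  intro φ hφ hc v
  have h1 := h (fun x => φ x • perp v) (hφ.smul contDiff_const) hc.smul_right
  have h2 : ∀ x, curl (fun y => φ y • perp v) x = fderiv ℝ φ x v := by
    intro x
    rw [curl_smul_const hφ]
    have : fderiv ℝ φ x v = inner ℝ (gradient φ x) v := by simp [gradient]
    rw [this, PiLp.inner_apply, PiLp.inner_apply]
    simp [perp_apply, Fin.sum_univ_two]
    ring
  have hl := (integrable_of_smooth hφ hc l).abs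
  have hk := (integrable_of_smooth hφ hc κ).abs
  simp only [h2, norm_smul, norm_perp, real_inner_smul_right, Real.norm_eq_abs] at h1
  rw [integral_mul_const, integral_mul_const] at h1
  have h3 : |inner ℝ τ (perp v)| ≤ ‖v‖ := by
    refine (abs_real_inner_le_norm _ _).trans ?_
    rw [norm_perp]
    exact mul_le_of_le_one_left (norm_nonneg _) hτ
  have h4 : |(∫ x, φ x ∂l) * inner ℝ τ (perp v)| ≤ (∫ x, |φ x| ∂l) * ‖v‖ := by
    rw [abs_mul]
    exact mul_le_mul (abs_integral_le_integral_abs) h3 (abs_nonneg _)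
      (integral_nonneg fun x => abs_nonneg _)
  rw [integral_add_measure hk hl]
  have h5 := abs_sub_abs_le_abs_sub (∫ x, u x * fderiv ℝ φ x v)
    (-((∫ x, φ x ∂l) * inner ℝ τ (perp v)))
  rw [sub_neg_eq_add, abs_neg] at h5
  linarith

/-- The mollification of `u` by a smooth bump function. -/
def mollify (ρ : ContDiffBump (0 : Plane)) (u : Plane → ℝ) : Plane → ℝ :=
  convolution (ρ.normed volume) u (ContinuousLinearMap.lsmul ℝ ℝ) volume

variable {u : Plane → ℝ} {ν : Measure Plane} {ρ : ContDiffBump (0 : Plane)}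

theorem mollify_eq (ρ : ContDiffBump (0 : Plane)) (u : Plane → ℝ) (x : Plane) :
    mollify ρ u x = ∫ y, ρ.normed volume (x - y) * u y := by
  rw [mollify, convolution_lsmul_swap]
  rfl

theorem mollify_eq' (ρ : ContDiffBump (0 : Plane)) (u : Plane → ℝ) (x : Plane) :
    mollify ρ u x = ∫ y, ρ.normed volume y * u (x - y) := rfl

theorem contDiff_mollify (hu : Integrable u) : ContDiff ℝ ∞ (mollify ρ u) :=
  ρ.hasCompactSupport_normed.contDiff_convolution_left _ ρ.contDiff_normed hu.locallyIntegrable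

theorem hasCompactSupport_mollify (hc : HasCompactSupport u) : HasCompactSupport (mollify ρ u) :=
  ρ.hasCompactSupport_normed.convolution _ hc

theorem fderiv_mollify (hu : Integrable u) (x v : Plane) :
    fderiv ℝ (mollify ρ u) x v = ∫ y, u y * fderiv ℝ (ρ.normed volume) (x - y) v := by
  have h : mollify ρ u =
      convolution u (ρ.normed volume) (ContinuousLinearMap.lsmul ℝ ℝ).flip volume := by
    rw [convolution_flip]; rfl
  have hρ : ContDiff ℝ 1 (ρ.normed (volume : Measure Plane)) := ρ.contDiff_normed (n := 1)
  rw [h, (ρ.hasCompactSupport_normed.hasFDerivAt_convolution_right _ hu.locallyIntegrable hρ x).fderiv,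
    convolution_precompR_apply _ hu.locallyIntegrable (ρ.hasCompactSupport_normed.fderiv ℝ)
      (hρ.continuous_fderiv one_ne_zero)]
  rw [convolution_def]
  refine integral_congr_ae (Eventually.of_forall fun y => ?_)
  simp [mul_comm]

theorem contDiff_normed_sub (x : Plane) :
    ContDiff ℝ ∞ fun y => ρ.normed (volume : Measure Plane) (x - y) :=
  (ρ.contDiff_normed (n := ⊤)).comp (contDiff_const.sub contDiff_id)

theorem hasCompactSupport_normed_sub (x : Plane) :
    HasCompactSupport fun y => ρ.normed (volume : Measure Plane) (x - y) :=
  ρ.hasCompactSupport_normed.comp_homeomorph (Homeomorph.subLeft x)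

/-- The derivative of the mollification at `x` is, up to sign, the pairing that `GradBound`
controls, with the kernel centred at `x` as test function. -/
theorem norm_fderiv_mollify_le (hu : Integrable u) (h : GradBound u ν) (x : Plane) :
    ‖fderiv ℝ (mollify ρ u) x‖ ≤ ∫ y, ρ.normed volume (x - y) ∂ν := by
  have hnn : ∀ y, 0 ≤ ρ.normed (volume : Measure Plane) (x - y) := fun y => ρ.nonneg_normed _
  refine ContinuousLinearMap.opNorm_le_bound _ (integral_nonneg hnn) fun v => ?_
  have h1 := h _ (contDiff_normed_sub (ρ := ρ) x) (hasCompactSupport_normed_sub x) v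
  have h2 : ∀ y, fderiv ℝ (fun y => ρ.normed (volume : Measure Plane) (x - y)) y v =
      -fderiv ℝ (ρ.normed volume) (x - y) v := by
    intro y
    have hd : DifferentiableAt ℝ (ρ.normed (volume : Measure Plane)) (x - y) :=
      (ρ.contDiff_normed (n := 1)).differentiable (by simp) _
    have := (hd.hasFDerivAt.comp y ((hasFDerivAt_id y).const_sub x)).fderiv
    rw [show (fun y => ρ.normed (volume : Measure Plane) (x - y)) =
      ρ.normed volume ∘ HSub.hSub x from rfl, this]
    simp
  simp only [h2, mul_neg, integral_neg, abs_neg] at h1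
  rw [fderiv_mollify hu, mul_comm, Real.norm_eq_abs]
  refine h1.trans_eq ?_
  simp only [abs_of_nonneg (hnn _)]

theorem lintegral_normed_sub_left (ρ : ContDiffBump (0 : Plane)) (y : Plane) :
    ∫⁻ x, ENNReal.ofReal (ρ.normed volume (x - y)) = 1 := by
  rw [lintegral_sub_right_eq_self (fun x => ENNReal.ofReal (ρ.normed volume x)),
    ← ofReal_integral_eq_lintegral_ofReal ρ.integrable_normed
      (Eventually.of_forall fun x => ρ.nonneg_normed x), ρ.integral_normed, ENNReal.ofReal_one]

/-- The total variation does not increase under mollification. -/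
theorem lintegral_fderiv_mollify_le [IsFiniteMeasure ν] (hu : Integrable u) (h : GradBound u ν) :
    ∫⁻ x, ‖fderiv ℝ (mollify ρ u) x‖ₑ ≤ ν univ := by
  have hρc : Continuous (ρ.normed (volume : Measure Plane)) := ρ.continuous_normed
  calc ∫⁻ x, ‖fderiv ℝ (mollify ρ u) x‖ₑ
      ≤ ∫⁻ x, ∫⁻ y, ENNReal.ofReal (ρ.normed volume (x - y)) ∂ν := by
        refine lintegral_mono fun x => ?_
        rw [← ofReal_norm, ← ofReal_integral_eq_lintegral_ofReal
          (integrable_of_smooth (contDiff_normed_sub x) (hasCompactSupport_normed_sub x) ν)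
          (Eventually.of_forall fun y => ρ.nonneg_normed _)]
        exact ENNReal.ofReal_le_ofReal (norm_fderiv_mollify_le hu h x)
    _ = ∫⁻ y, (∫⁻ x, ENNReal.ofReal (ρ.normed volume (x - y))) ∂ν := by
        rw [lintegral_lintegral_swap]
        exact (ENNReal.continuous_ofReal.comp (hρc.comp (continuous_fst.sub continuous_snd))).measurable.aemeasurable
    _ = ν univ := by simp [lintegral_normed_sub_left]

/-- A sequence of bump functions whose supports shrink to the origin. -/
def bumpSeq (n : ℕ) : ContDiffBump (0 : Plane) :=
  ⟨1 / (2 * (n + 1)), 1 / (n + 1), by positivity, by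
    rw [one_div_lt_one_div (by positivity) (by positivity)]; linarith⟩

theorem ae_tendsto_mollify (hu : Integrable u) :
    ∀ᵐ x, Tendsto (fun n => mollify (bumpSeq n) u x) atTop (𝓝 (u x)) := by
  -- The outer radius is exactly twice the inner one; a bounded ratio is what Lebesgue
  -- differentiation requires.
  refine ContDiffBump.ae_convolution_tendsto_right_of_locallyIntegrable (K := 2)
    tendsto_one_div_add_atTop_nhds_zero_nat (Eventually.of_forall fun n => ?_) hu.locallyIntegrable
  change (1 : ℝ) / (n + 1) ≤ 2 * (1 / (2 * (n + 1)))
  rw [show (2 : ℝ) * (1 / (2 * (n + 1))) = 1 / (n + 1) by field_simp]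

/-- The Gagliardo-Nirenberg-Sobolev inequality for functions of bounded variation in the plane. -/
theorem exists_sobolev_const : ∃ K : ℝ≥0∞, K ≠ ⊤ ∧ ∀ (u : Plane → ℝ) (ν : Measure Plane),
    IsFiniteMeasure ν → Integrable u → HasCompactSupport u → GradBound u ν →
      eLpNorm u 2 volume ≤ K * ν univ := by
  refine ⟨eLpNormLESNormFDerivOneConst (volume : Measure Plane) 2, ENNReal.coe_ne_top,
    fun u ν hν hu hc h => ?_⟩
  -- Fatou along the mollifications reduces to smooth functions. The exponent `2` is the conjugate
  -- of the dimension `2`.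
  refine Lp.eLpNorm_le_of_ae_tendsto (Eventually.of_forall fun n => ?_)
    (fun n => (contDiff_mollify (ρ := bumpSeq n) hu).continuous.aestronglyMeasurable)
    (ae_tendsto_mollify hu)
  have hp : NNReal.HolderConjugate (Module.finrank ℝ Plane) (2 : NNReal) := by
    rw [finrank_euclideanSpace_fin]
    exact NNReal.HolderConjugate.two_two
  have h1 := eLpNorm_le_eLpNorm_fderiv_one volume
    ((contDiff_mollify (ρ := bumpSeq n) hu).of_le (by simp))
    (hasCompactSupport_mollify hc) hp
  simp only [NNReal.coe_ofNat, ENNReal.coe_ofNat] at h1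
  refine h1.trans ?_
  gcongr
  rw [eLpNorm_one_eq_lintegral_enorm]
  exact lintegral_fderiv_mollify_le hu h

/-- The increment is the integral of the derivative along the segment from `x` to `x - z`; Tonelli
and translation invariance do the rest. -/
theorem lintegral_translate_sub_le_of_smooth {f : Plane → ℝ} (hf : ContDiff ℝ ∞ f) (z : Plane) :
    ∫⁻ x, ‖f (x - z) - f x‖ₑ ≤ ‖z‖ₑ * ∫⁻ x, ‖fderiv ℝ f x‖ₑ := by
  have hcf : Continuous (fderiv ℝ f) := hf.continuous_fderiv (by simp)
  have h1 : ∀ x, ‖f (x - z) - f x‖ₑ ≤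
      ‖z‖ₑ * ∫⁻ t in Icc (0 : ℝ) 1, ‖fderiv ℝ f (x + t • (-z))‖ₑ := by
    intro x
    have hd : ∀ t : ℝ, HasDerivAt (fun t : ℝ => f (x + t • (-z)))
        (fderiv ℝ f (x + t • (-z)) (-z)) t := by
      intro t
      have e : HasDerivAt (fun t : ℝ => x + t • (-z)) (-z) t := by
        simpa using ((hasDerivAt_id t).smul_const (-z)).const_add x
      exact (hf.differentiable (by simp) _).hasFDerivAt.comp_hasDerivAt t e
    have hcont : Continuous fun t : ℝ => fderiv ℝ f (x + t • (-z)) (-z) :=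
      (hcf.comp (by fun_prop)).clm_apply continuous_const
    have h2 := intervalIntegral.integral_eq_sub_of_hasDerivAt (a := 0) (b := 1)
      (fun t _ => hd t) (hcont.intervalIntegrable _ _)
    simp only [one_smul, zero_smul, add_zero, ← sub_eq_add_neg] at h2
    rw [← h2, intervalIntegral.integral_of_le zero_le_one, ← integral_Icc_eq_integral_Ioc]
    refine (enorm_integral_le_lintegral_enorm _).trans ?_
    rw [← lintegral_const_mul']
    · refine lintegral_mono fun t => ?_
      refine (ContinuousLinearMap.le_opENorm _ _).trans ?_
      rw [enorm_neg, mul_comm]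
    · exact enorm_ne_top
  calc ∫⁻ x, ‖f (x - z) - f x‖ₑ
      ≤ ∫⁻ x, ‖z‖ₑ * ∫⁻ t in Icc (0 : ℝ) 1, ‖fderiv ℝ f (x + t • (-z))‖ₑ := lintegral_mono h1
    _ = ‖z‖ₑ * ∫⁻ x, ∫⁻ t in Icc (0 : ℝ) 1, ‖fderiv ℝ f (x + t • (-z))‖ₑ :=
        lintegral_const_mul' _ _ enorm_ne_top
    _ = ‖z‖ₑ * ∫⁻ t in Icc (0 : ℝ) 1, ∫⁻ x, ‖fderiv ℝ f (x + t • (-z))‖ₑ := by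
        rw [lintegral_lintegral_swap]
        refine Measurable.aemeasurable (Continuous.measurable ?_)
        exact (hcf.comp (by fun_prop)).enorm
    _ = ‖z‖ₑ * ∫⁻ x, ‖fderiv ℝ f x‖ₑ := by
        congr 1
        simp_rw [lintegral_add_right_eq_self fun x => ‖fderiv ℝ f x‖ₑ]
        simp

theorem lintegral_translate_sub_le [IsFiniteMeasure ν] (hu : Integrable u) (h : GradBound u ν)
    (z : Plane) : ∫⁻ x, ‖u (x - z) - u x‖ₑ ≤ ‖z‖ₑ * ν univ := by
  have h1 := Lp.eLpNorm_le_of_ae_tendsto (p := 1) (μ := (volume : Measure Plane)) (u := atTop)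
    (f := fun n x => mollify (bumpSeq n) u (x - z) - mollify (bumpSeq n) u x)
    (g := fun x => u (x - z) - u x) (C := ‖z‖ₑ * ν univ) (Eventually.of_forall fun n => by
      rw [eLpNorm_one_eq_lintegral_enorm]
      refine (lintegral_translate_sub_le_of_smooth (contDiff_mollify hu) z).trans ?_
      gcongr
      exact lintegral_fderiv_mollify_le hu h)
    (fun n => by
      have := (contDiff_mollify (ρ := bumpSeq n) hu).continuous
      exact ((this.comp (continuous_sub_right z)).sub this).aestronglyMeasurable)
    (by
      have h2 := (measurePreserving_sub_right (volume : Measure Plane) z).quasiMeasurePreserving.ae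
        (ae_tendsto_mollify hu)
      filter_upwards [h2, ae_tendsto_mollify hu] with x hx hx'
      exact hx.sub hx')
  rwa [eLpNorm_one_eq_lintegral_enorm] at h1

/-- A mollification averages translations by vectors shorter than `rOut`. The error depends on `u`
only through the mass of `ν`, hence is uniform over competitors of bounded energy. -/
theorem lintegral_sub_mollify_le [IsFiniteMeasure ν] (hu : Integrable u) (h : GradBound u ν) :
    ∫⁻ x, ‖mollify ρ u x - u x‖ₑ ≤ ENNReal.ofReal ρ.rOut * ν univ := by
  have hρi : Integrable (ρ.normed (volume : Measure Plane)) := ρ.integrable_normed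
  have hρc : Continuous (ρ.normed (volume : Measure Plane)) := ρ.continuous_normed
  have hex : ConvolutionExists (ρ.normed volume) u (ContinuousLinearMap.lsmul ℝ ℝ) volume :=
    ρ.hasCompactSupport_normed.convolutionExists_left _ hρc hu.locallyIntegrable
  have h1 : ∀ x, ‖mollify ρ u x - u x‖ₑ ≤
      ∫⁻ y, ENNReal.ofReal (ρ.normed volume y) * ‖u (x - y) - u x‖ₑ := by
    intro x
    have e : mollify ρ u x - u x = ∫ y, ρ.normed volume y * (u (x - y) - u x) := by
      have : u x = ∫ y, ρ.normed volume y * u x := by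
        rw [integral_mul_const, ρ.integral_normed, one_mul]
      rw [mollify_eq']
      conv_lhs => rw [this]
      have hi : Integrable fun y => ρ.normed (volume : Measure Plane) y * u (x - y) := hex x
      rw [← integral_sub hi (hρi.mul_const _)]
      simp only [mul_sub]
    rw [e]
    refine (enorm_integral_le_lintegral_enorm _).trans_eq ?_
    refine lintegral_congr fun y => ?_
    rw [enorm_mul, Real.enorm_of_nonneg (ρ.nonneg_normed y)]
  calc ∫⁻ x, ‖mollify ρ u x - u x‖ₑ
      ≤ ∫⁻ x, ∫⁻ y, ENNReal.ofReal (ρ.normed volume y) * ‖u (x - y) - u x‖ₑ := lintegral_mono h1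
    _ = ∫⁻ y, ∫⁻ x, ENNReal.ofReal (ρ.normed volume y) * ‖u (x - y) - u x‖ₑ := by
        rw [lintegral_lintegral_swap]
        refine AEMeasurable.mul (f := fun p : Plane × Plane => ENNReal.ofReal (ρ.normed volume p.2))
          (g := fun p : Plane × Plane => ‖u (p.1 - p.2) - u p.1‖ₑ) ?_ ?_
        · exact (ENNReal.continuous_ofReal.comp (hρc.comp continuous_snd)).measurable.aemeasurable
        · refine AEStronglyMeasurable.enorm ?_
          refine AEStronglyMeasurable.sub ?_ hu.1.comp_fst
          exact hu.1.comp_quasiMeasurePreserving (quasiMeasurePreserving_sub _ _)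
    _ ≤ ∫⁻ y, ENNReal.ofReal (ρ.normed volume y) * (ENNReal.ofReal ρ.rOut * ν univ) := by
        refine lintegral_mono fun y => ?_
        rw [lintegral_const_mul' _ _ ENNReal.ofReal_ne_top]
        by_cases hy : y ∈ Metric.ball (0 : Plane) ρ.rOut
        · gcongr
          refine (lintegral_translate_sub_le hu h y).trans ?_
          gcongr
          rw [← ofReal_norm]
          exact ENNReal.ofReal_le_ofReal (by simpa using (Metric.mem_ball.1 hy).le)
        · rw [← ρ.support_normed_eq (μ := volume), Function.notMem_support] at hy
          simp [hy]
    _ = ENNReal.ofReal ρ.rOut * ν univ := by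
        rw [lintegral_mul_const' _ _ (ENNReal.mul_ne_top ENNReal.ofReal_ne_top (measure_ne_top _ _))]
        have := lintegral_normed_sub_left ρ 0
        simp only [sub_zero] at this
        rw [this, one_mul]

end PlanarSteiner

/-! ### Cutoff functions, a differential inequality and Lebesgue points of a density. -/

namespace PlanarSteiner

theorem exists_bound_deriv_smoothTransition :
    ∃ C : ℝ, 0 < C ∧ ∀ t, |deriv Real.smoothTransition t| ≤ C := by
  have hc : Continuous (deriv Real.smoothTransition) :=
    (Real.smoothTransition.contDiff (n := 1)).continuous_deriv le_rfl
  obtain ⟨C, hC⟩ := (isCompact_Icc (a := (0 : ℝ)) (b := 1)).exists_bound_of_continuousOn hc.continuousOn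
  refine ⟨max C 1, by positivity, fun t => ?_⟩
  rcases lt_or_ge t 0 with h0 | h0
  · have : deriv Real.smoothTransition t = 0 := by
      refine IsLocalMin.deriv_eq_zero (Eventually.of_forall fun s => ?_)
      rw [Real.smoothTransition.zero_of_nonpos h0.le]
      exact Real.smoothTransition.nonneg s
    rw [this, abs_zero]; positivity
  rcases lt_or_ge 1 t with h1 | h1
  · have : deriv Real.smoothTransition t = 0 := by
      refine IsLocalMax.deriv_eq_zero (Eventually.of_forall fun s => ?_)
      rw [Real.smoothTransition.one_of_one_le h1.le]
      exact Real.smoothTransition.le_one s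
    rw [this, abs_zero]; positivity
  · exact (hC t ⟨h0, h1⟩).trans (le_max_left _ _)

/-- Smooth cutoff functions between concentric balls, with the optimal bound on the gradient. -/
theorem exists_cutoff : ∃ C : ℝ, 0 < C ∧ ∀ (x : Plane) (r δ : ℝ), 0 < r → 0 < δ →
    ∃ η : Plane → ℝ, ContDiff ℝ ∞ η ∧ HasCompactSupport η ∧ (∀ y, 0 ≤ η y) ∧ (∀ y, η y ≤ 1) ∧
      (∀ y ∈ Metric.closedBall x r, η y = 1) ∧ (∀ y ∉ Metric.closedBall x (r + δ), η y = 0) ∧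
      ∀ y, ‖fderiv ℝ η y‖ ≤
        (Metric.closedBall x (r + δ) \ Metric.closedBall x r).indicator (fun _ => C / δ) y := by
  obtain ⟨C, hC, hCb⟩ := exists_bound_deriv_smoothTransition
  refine ⟨2 * C, by positivity, fun x r δ hr hδ => ?_⟩
  -- The profile depends on `‖y - x‖²`, so it is smooth at the centre. As `a = δ (2r + δ)`, its
  -- slope on the annulus is at most `2 (r + δ) / a ≤ 2 / δ`, whatever `r` is.
  set a : ℝ := (r + δ) ^ 2 - r ^ 2
  have ha : 0 < a := by simp only [a]; nlinarith
  let g : Plane → ℝ := fun y => ((r + δ) ^ 2 - ‖y - x‖ ^ 2) / a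
  let η : Plane → ℝ := fun y => Real.smoothTransition (g y)
  have hg : ContDiff ℝ ∞ g :=
    ((contDiff_const.sub ((contDiff_id.sub contDiff_const).norm_sq ℝ)).div_const _)
  have hη : ContDiff ℝ ∞ η := (Real.smoothTransition.contDiff (n := ⊤)).comp hg
  have h0 : ∀ y, 0 ≤ η y := fun y => Real.smoothTransition.nonneg _
  have h1 : ∀ y, η y ≤ 1 := fun y => Real.smoothTransition.le_one _
  have hin : ∀ y ∈ Metric.closedBall x r, η y = 1 := by
    intro y hy
    rw [mem_closedBall_iff_norm] at hy
    refine Real.smoothTransition.one_of_one_le ?_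
    rw [le_div_iff₀ ha, one_mul]
    have := pow_le_pow_left₀ (norm_nonneg _) hy 2
    simp only [a]; linarith
  have hout : ∀ y ∉ Metric.closedBall x (r + δ), η y = 0 := by
    intro y hy
    rw [mem_closedBall_iff_norm, not_le] at hy
    refine Real.smoothTransition.zero_of_nonpos (div_nonpos_of_nonpos_of_nonneg ?_ ha.le)
    have := pow_le_pow_left₀ (by positivity) hy.le 2
    linarith
  refine ⟨η, hη, HasCompactSupport.intro (isCompact_closedBall x (r + δ)) hout, h0, h1, hin, hout,
    fun y => ?_⟩
  by_cases hy1 : y ∈ Metric.closedBall x r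
  · have : fderiv ℝ η y = 0 := IsLocalMax.fderiv_eq_zero
      (Eventually.of_forall fun s => by rw [hin y hy1]; exact h1 s)
    rw [this, norm_zero]
    exact indicator_nonneg (fun _ _ => by positivity) _
  by_cases hy2 : y ∈ Metric.closedBall x (r + δ)
  · rw [indicator_of_mem (mem_sdiff_of_mem hy2 hy1)]
    have hgd : HasFDerivAt g (a⁻¹ • ((0 : Plane →L[ℝ] ℝ) - 2 • (innerSL ℝ (y - x)).comp
        (ContinuousLinearMap.id ℝ Plane))) y := by
      have := (((hasFDerivAt_const ((r + δ) ^ 2) y).sub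
        (((hasFDerivAt_id y).sub_const x).norm_sq)).const_mul a⁻¹)
      refine this.congr_of_eventuallyEq (Eventually.of_forall fun s => ?_)
      simp [g, div_eq_inv_mul]
    have hd : HasFDerivAt η _ y :=
      ((Real.smoothTransition.contDiff (n := 1)).differentiable (by simp) (g y)).hasDerivAt.comp_hasFDerivAt
        y hgd
    rw [hd.fderiv, norm_smul, Real.norm_eq_abs]
    have h3 : ‖a⁻¹ • ((0 : Plane →L[ℝ] ℝ) - 2 • (innerSL ℝ (y - x)).comp
        (ContinuousLinearMap.id ℝ Plane))‖ ≤ 2 / δ := by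
      rw [norm_smul, zero_sub, norm_neg, ContinuousLinearMap.comp_id, norm_inv, Real.norm_of_nonneg ha.le]
      have h4 : ‖2 • innerSL ℝ (y - x)‖ ≤ 2 * (r + δ) := by
        rw [two_smul, two_mul]
        refine (norm_add_le _ _).trans ?_
        rw [innerSL_apply_norm]
        rw [mem_closedBall_iff_norm] at hy2
        linarith
      calc a⁻¹ * ‖2 • innerSL ℝ (y - x)‖ ≤ a⁻¹ * (2 * (r + δ)) := by gcongr
        _ ≤ 2 / δ := by
          rw [inv_mul_eq_div, div_le_div_iff₀ ha hδ]
          simp only [a]; nlinarith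
    calc _ ≤ C * (2 / δ) := mul_le_mul (hCb _) h3 (norm_nonneg _) hC.le
      _ = 2 * C / δ := by ring
  · have : fderiv ℝ η y = 0 := IsLocalMin.fderiv_eq_zero
      (Eventually.of_forall fun s => by rw [hout y hy2]; exact h0 s)
    rw [this, norm_zero]
    exact indicator_nonneg (fun _ _ => by positivity) _

/-- A positive function with `m' ≥ c √m` grows at least quadratically. -/
theorem sq_le_of_sqrt_le_slope {m : ℝ → ℝ} {c R : ℝ} (hc : 0 < c) (hm : ContinuousOn m (Ioo 0 R))
    (hpos : ∀ r ∈ Ioo 0 R, 0 < m r)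
    (hslope : ∀ r ∈ Ioo 0 R, ∀ a < c * √(m r), ∀ᶠ t in 𝓝[>] r, a < slope m r t)
    {r : ℝ} (hr : r ∈ Ioo 0 R) : (c / 8 * r) ^ 2 ≤ m r := by
  have hs : r / 2 ∈ Ioo 0 R := ⟨by linarith [hr.1], by linarith [hr.1, hr.2]⟩
  have hsub : Icc (r / 2) r ⊆ Ioo 0 R := fun t ht => ⟨hs.1.trans_le ht.1, ht.2.trans_lt hr.2⟩
  -- Comparison, with signs reversed, against the barrier `B(t) = (c/4 · (t - r/2))²`, for which `B'
  -- = (c/2) √B` is strictly below `c √B` where `B > 0`. Starting at `r/2` stays away from `0`,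
  -- where nothing is known about `m`.
  have key := image_le_of_liminf_slope_right_lt_deriv_boundary' (f := fun t => -m t)
    (f' := fun t => -(c * √(m t))) (a := r / 2) (b := r) (hm.mono hsub).neg
    (fun t ht a hat => by
      have h1 := hslope t (hsub (Ico_subset_Icc_self ht)) (-a) (by linarith)
      refine (h1.mono fun s hs' => ?_).frequently
      have : slope (fun t => -m t) t s = -slope m t s := by
        simp only [slope_def_field]; ring
      rw [this]; linarith)
    (B := fun t => -(c / 4 * (t - r / 2)) ^ 2) (B' := fun t => -(2 * (c / 4) ^ 2 * (t - r / 2)))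
    (by simpa using (hpos _ hs).le) (by fun_prop)
    (fun t _ => by
      have h1 := ((((hasDerivAt_id t).sub_const (r / 2)).const_mul (c / 4)).pow 2).neg
      refine (h1.congr_deriv ?_).hasDerivWithinAt
      simp; ring)
    -- A contact of `m` with the barrier cannot occur at `t = r/2`, where the barrier vanishes and
    -- `m > 0`; this makes the derivative comparison strict.
    (fun t ht htB => by
      have h1 : m t = (c / 4 * (t - r / 2)) ^ 2 := by simpa using htB
      have h2 : 0 ≤ c / 4 * (t - r / 2) := mul_nonneg (by positivity) (by linarith [ht.1])
      have h3 : 0 < c / 4 * (t - r / 2) := by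
        have := hpos t (hsub (Ico_subset_Icc_self ht))
        rcases h2.eq_or_lt with h | h
        · rw [h1, ← h] at this; simp at this
        · exact h
      rw [h1, Real.sqrt_sq h2]
      nlinarith)
    (right_mem_Icc.2 (by linarith [hr.1]))
  have : -m r ≤ -(c / 4 * (r - r / 2)) ^ 2 := key
  calc (c / 8 * r) ^ 2 = (c / 4 * (r - r / 2)) ^ 2 := by ring
    _ ≤ m r := by linarith

/-- At almost every point, the variation of a vector measure on small balls is comparable with the
norm of the measure of the ball. -/
theorem ae_integral_norm_le_two_mul {ν : Measure Plane} [IsFiniteMeasure ν] {k : Plane → Plane}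
    (hk : Integrable k ν) : ∀ᵐ x ∂ν, k x ≠ 0 → ∃ R > 0, ∀ r ∈ Ioo 0 R,
      0 < ∫ y in Metric.closedBall x r, ‖k y‖ ∂ν ∧
      ∫ y in Metric.closedBall x r, ‖k y‖ ∂ν ≤ 2 * ‖∫ y in Metric.closedBall x r, k y ∂ν‖ := by
  filter_upwards [(Besicovitch.vitaliFamily ν).ae_tendsto_average_norm_sub hk.locallyIntegrable,
    (Besicovitch.vitaliFamily ν).ae_eventually_measure_pos] with x hx hx' hkx
  have hn : 0 < ‖k x‖ := norm_pos_iff.2 hkx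
  -- With mean oscillation below `|k x|/4`, the integral of `|k|` is at most `5/4 |k x| ν(B)` and
  -- the norm of the integral is at least `3/4 |k x| ν(B)`; the ratio is below `2`.
  have h1 := (hx.comp (Besicovitch.tendsto_filterAt ν x)).eventually
    (gt_mem_nhds (show (0 : ℝ) < ‖k x‖ / 4 by positivity))
  have h2 := (Besicovitch.tendsto_filterAt ν x).eventually hx'
  obtain ⟨R, hR, hR'⟩ := mem_nhdsGT_iff_exists_Ioo_subset.1 (h1.and h2)
  refine ⟨R, hR, fun r hr => ?_⟩
  obtain ⟨h3, h4⟩ := hR' hr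
  set B := Metric.closedBall x r
  have hB : 0 < ν.real B := ENNReal.toReal_pos h4.ne' (measure_ne_top _ _)
  simp only [Function.comp_apply, setAverage_eq, smul_eq_mul] at h3
  rw [inv_mul_eq_div, div_lt_iff₀ hB] at h3
  have hkB : Integrable k (ν.restrict B) := hk.integrableOn
  have hcB : Integrable (fun _ => k x) (ν.restrict B) := integrable_const _
  have hcN : Integrable (fun _ => ‖k x‖) (ν.restrict B) := integrable_const _
  have e1 : ∫ y in B, ‖k y‖ ∂ν ≤ ∫ y in B, ‖k y - k x‖ ∂ν + ‖k x‖ * ν.real B := by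
    have : ‖k x‖ * ν.real B = ∫ y in B, ‖k x‖ ∂ν := by simp [mul_comm]
    have hd : Integrable (fun y => ‖k y - k x‖) (ν.restrict B) := (hkB.sub hcB).norm
    rw [this, ← integral_add hd hcN]
    refine integral_mono hkB.norm (hd.add hcN) fun y => ?_
    have := norm_add_le (k y - k x) (k x)
    simpa using this
  have e2 : ‖k x‖ * ν.real B ≤ ‖∫ y in B, k y ∂ν‖ + ∫ y in B, ‖k y - k x‖ ∂ν := by
    have h5 : ∫ y in B, (k y - k x) ∂ν = (∫ y in B, k y ∂ν) - ν.real B • k x := by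
      rw [integral_sub hkB hcB]; simp
    have h6 : ‖ν.real B • k x‖ = ‖k x‖ * ν.real B := by
      rw [norm_smul, Real.norm_of_nonneg hB.le, mul_comm]
    rw [← h6]
    have h7 := norm_integral_le_integral_norm (μ := ν.restrict B) fun y => k y - k x
    rw [h5] at h7
    have h8 := norm_sub_norm_le (ν.real B • k x) (∫ y in B, k y ∂ν)
    rw [norm_sub_rev] at h8
    linarith
  have e3 := norm_integral_le_integral_norm (μ := ν.restrict B) k
  have e4 : 0 < ‖k x‖ * ν.real B := by positivity
  constructor <;> linarith

end PlanarSteiner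

/-! ### Estimates on concentric balls obtained from cutoffs. -/

namespace PlanarSteiner

/-- The gradient of `w` is the vector measure with density `k` with respect to `ν`. -/
def HasGradDensity (w : Plane → ℝ) (ν : Measure Plane) (k : Plane → Plane) : Prop :=
  ∀ φ : Plane → ℝ, ContDiff ℝ ∞ φ → HasCompactSupport φ → ∀ v : Plane,
    ∫ x, w x * fderiv ℝ φ x v = -∫ x, φ x * inner ℝ (k x) v ∂ν

theorem integral_fderiv_eq_zero {φ : Plane → ℝ} (hφ : ContDiff ℝ ∞ φ) (hc : HasCompactSupport φ)
    (v : Plane) : ∫ x, fderiv ℝ φ x v = 0 := by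
  have hi : Integrable fun x => fderiv ℝ φ x v :=
    (continuous_fderiv_apply_of_smooth hφ v).integrable_of_hasCompactSupport (hc.fderiv_apply ℝ v)
  have h := integral_mul_fderiv_eq_neg_fderiv_mul_of_integrable (μ := (volume : Measure Plane))
    (f := fun _ => (1 : ℝ)) (g := φ) (v := v) (by simp) (by simpa using hi)
    (by simpa using hφ.continuous.integrable_of_hasCompactSupport hc) (fun _ _ => by fun_prop)
    (fun x _ => hφ.differentiable (by simp) x)
  simpa using h

/-- Derivatives of test functions have zero integral, so a constant may be subtracted. The
difference is only locally integrable, whence the separate predicate. -/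
theorem IsDistribGradient.hasGradDensity {u : Plane → ℝ} {ν : Measure Plane} {k : Plane → Plane}
    (hu : Integrable u) (hk : Integrable k ν) (h : IsDistribGradient u (ν.withDensityᵥ k)) (c : ℝ) :
    HasGradDensity (fun x => u x - c) ν k := by
  intro φ hφ hc v
  have hfin := isFiniteMeasure_variation (ν.withDensityᵥ k)
  have h1 := h φ hφ hc
  rw [integral_withDensityᵥ hk (integrable_of_smooth hφ hc _)] at h1
  have hki : Integrable (fun x => φ x • k x) ν := by
    obtain ⟨C, hC⟩ := hφ.continuous.bounded_above_of_compact_support hc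
    exact hk.bdd_smul C hφ.continuous.aestronglyMeasurable (Eventually.of_forall hC)
  have h2 := congrArg (fun z => inner ℝ v z) h1
  simp only [inner_neg_right] at h2
  rw [← integral_inner hki v, ← integral_inner (integrable_smul_gradient hu hφ hc) v] at h2
  simp only [real_inner_smul_right] at h2
  have h3 : ∀ x, inner ℝ v (gradient φ x) = fderiv ℝ φ x v := fun x => by
    rw [real_inner_comm]; simp [gradient]
  have hi : Integrable fun x => fderiv ℝ φ x v :=
    (continuous_fderiv_apply_of_smooth hφ v).integrable_of_hasCompactSupport (hc.fderiv_apply ℝ v)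
  have hui : Integrable fun x => u x * fderiv ℝ φ x v :=
    integrable_mul_of_continuous_hasCompactSupport hu
      (continuous_fderiv_apply_of_smooth hφ v) (hc.fderiv_apply ℝ v)
  simp only [h3] at h2
  simp only [sub_mul]
  rw [integral_sub hui (hi.const_mul c), integral_const_mul, integral_fderiv_eq_zero hφ hc, h2]
  simp [real_inner_comm]

section Density

variable {w : Plane → ℝ} {ν : Measure Plane} {k : Plane → Plane}

theorem setIntegral_annulus {E : Type*} [NormedAddCommGroup E] [NormedSpace ℝ E] {μ : Measure Plane}
    {f : Plane → E} (hf : LocallyIntegrable f μ) (x : Plane) {r δ : ℝ} (hδ : 0 < δ) :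
    ∫ y in Metric.closedBall x (r + δ) \ Metric.closedBall x r, f y ∂μ =
      (∫ y in Metric.closedBall x (r + δ), f y ∂μ) - ∫ y in Metric.closedBall x r, f y ∂μ :=
  setIntegral_sdiff Metric.isClosed_closedBall.measurableSet
    (hf.integrableOn_isCompact (isCompact_closedBall _ _))
    (Metric.closedBall_subset_closedBall (by linarith))

theorem locallyIntegrable_abs (hw : LocallyIntegrable w) : LocallyIntegrable fun y => |w y| := by
  intro x
  obtain ⟨s, hs, h⟩ := hw x
  exact ⟨s, hs, h.norm⟩

theorem measurableSet_annulus (x : Plane) (r s : ℝ) :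
    MeasurableSet (Metric.closedBall x s \ Metric.closedBall x r) :=
  Metric.isClosed_closedBall.measurableSet.diff Metric.isClosed_closedBall.measurableSet

theorem integrableOn_annulus_abs (hw : LocallyIntegrable w) (x : Plane) (r s : ℝ) :
    IntegrableOn (fun y => |w y|) (Metric.closedBall x s \ Metric.closedBall x r) :=
  ((locallyIntegrable_abs hw).integrableOn_isCompact (isCompact_closedBall x s)).mono_set sdiff_subset

/-- An integral against the gradient of a cutoff function only sees the annulus. -/
theorem abs_integral_mul_fderiv_le (hw : LocallyIntegrable w) {c : ℝ} {x : Plane} {r s : ℝ}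
    {η ψ : Plane → ℝ} (v : Plane)
    (hψ : Continuous ψ)
    (hd : ∀ y, ‖fderiv ℝ η y‖ ≤
        (Metric.closedBall x s \ Metric.closedBall x r).indicator (fun _ => c) y) :
    |∫ y, w y * (ψ y * fderiv ℝ η y v)| ≤
      ‖v‖ * (c * ∫ y in Metric.closedBall x s \ Metric.closedBall x r, |ψ y| * |w y|) := by
  set A := Metric.closedBall x s \ Metric.closedBall x r with hA
  have hi : IntegrableOn (fun y => |ψ y| * |w y|) A := by
    have h1 := ((locallyIntegrable_abs hw).integrableOn_isCompact
      (isCompact_closedBall x s)).continuousOn_mul (g := fun y => |ψ y|) hψ.abs.continuousOn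
      (isCompact_closedBall x s)
    exact h1.mono_set sdiff_subset
  rw [← integral_const_mul, ← integral_const_mul, ← integral_indicator (measurableSet_annulus x r s)]
  refine norm_integral_le_of_norm_le (f := fun y => w y * (ψ y * fderiv ℝ η y v))
    ((integrable_indicator_iff (measurableSet_annulus x r s)).2 ((hi.const_mul c).const_mul ‖v‖))
    (Eventually.of_forall fun y => ?_)
  have h2 := (fderiv ℝ η y).le_opNorm v
  have h3 := hd y
  rw [norm_mul, norm_mul, Real.norm_eq_abs, Real.norm_eq_abs]
  by_cases hy : y ∈ A
  · rw [indicator_of_mem hy] at h3 ⊢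
    have h4 : ‖fderiv ℝ η y v‖ ≤ c * ‖v‖ := h2.trans (by gcongr)
    calc |w y| * (|ψ y| * ‖fderiv ℝ η y v‖) ≤ |w y| * (|ψ y| * (c * ‖v‖)) := by gcongr
      _ = _ := by ring
  · rw [indicator_of_notMem hy] at h3 ⊢
    have h4 : fderiv ℝ η y = 0 := norm_le_zero_iff.1 h3
    simp [h4]

/-- Put `V = ∫ η • k dν`. Pairing with `V` itself gives `|V|² = -∫ w ∂_V η`, which only sees the
annulus and is at most `|V| (C/δ) ∫ |w|` over it. The difference between `V` and the integral over
the inner ball is at most the integral of `|k|` over the annulus. -/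
theorem HasGradDensity.norm_setIntegral_le (h : HasGradDensity w ν k) (hw : LocallyIntegrable w)
    (hk : Integrable k ν) {C : ℝ} {x : Plane} {r δ : ℝ} (hδ : 0 < δ) {η : Plane → ℝ}
    (hη : ContDiff ℝ ∞ η) (hηc : HasCompactSupport η) (h0 : ∀ y, 0 ≤ η y) (h1 : ∀ y, η y ≤ 1)
    (hin : ∀ y ∈ Metric.closedBall x r, η y = 1)
    (hout : ∀ y ∉ Metric.closedBall x (r + δ), η y = 0)
    (hd : ∀ y, ‖fderiv ℝ η y‖ ≤
        (Metric.closedBall x (r + δ) \ Metric.closedBall x r).indicator (fun _ => C / δ) y) :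
    ‖∫ y in Metric.closedBall x r, k y ∂ν‖ ≤
      C / δ * ((∫ y in Metric.closedBall x (r + δ), |w y|) - ∫ y in Metric.closedBall x r, |w y|) +
      ((∫ y in Metric.closedBall x (r + δ), ‖k y‖ ∂ν) - ∫ y in Metric.closedBall x r, ‖k y‖ ∂ν) := by
  set A := Metric.closedBall x (r + δ) \ Metric.closedBall x r with hA
  have hAm : MeasurableSet A := measurableSet_annulus x r (r + δ)
  rw [← setIntegral_annulus (locallyIntegrable_abs hw) x hδ,
    ← setIntegral_annulus hk.norm.locallyIntegrable x hδ, ← hA]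
  have hki : Integrable (fun y => η y • k y) ν :=
    hk.bdd_smul 1 hη.continuous.aestronglyMeasurable (Eventually.of_forall fun y => by
      rw [Real.norm_of_nonneg (h0 y)]; exact h1 y)
  set V := ∫ y, η y • k y ∂ν with hVdef
  have hV : ‖V‖ ≤ C / δ * ∫ y in A, |w y| := by
    have e1 : ‖V‖ * ‖V‖ ≤ ‖V‖ * (C / δ * ∫ y in A, |w y|) := by
      rw [← real_inner_self_eq_norm_mul_norm]
      nth_rw 2 [hVdef]
      rw [← integral_inner hki V]
      have e2 := h η hη hηc V
      have e3 : ∫ y, inner ℝ V (η y • k y) ∂ν = -∫ y, w y * fderiv ℝ η y V := by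
        rw [e2, neg_neg]
        simp only [real_inner_smul_right, real_inner_comm V]
      rw [e3]
      have e4 := abs_integral_mul_fderiv_le hw (ψ := fun _ => 1) V continuous_const hd
      simp only [one_mul, abs_one] at e4
      exact (neg_le_abs _).trans e4
    have e5 : 0 ≤ C / δ * ∫ y in A, |w y| := by
      rcases A.eq_empty_or_nonempty with hA0 | ⟨y, hy⟩
      · simp [hA0]
      · refine mul_nonneg ?_ (integral_nonneg fun _ => abs_nonneg _)
        have := (norm_nonneg _).trans (hd y)
        rwa [indicator_of_mem hy] at this
    rcases (norm_nonneg V).eq_or_lt with hV0 | hV0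
    · rwa [← hV0]
    · exact le_of_mul_le_mul_left e1 hV0
  have hsplit : V = (∫ y in Metric.closedBall x r, k y ∂ν) + ∫ y in A, η y • k y ∂ν := by
    have f1 : ∫ y in Metric.closedBall x r, k y ∂ν = ∫ y in Metric.closedBall x r, η y • k y ∂ν :=
      setIntegral_congr_fun Metric.isClosed_closedBall.measurableSet fun y hy => by
        simp [hin y hy]
    rw [f1, ← setIntegral_union disjoint_sdiff_self_right hAm hki.integrableOn hki.integrableOn,
      union_sdiff_cancel (Metric.closedBall_subset_closedBall (by linarith)),
      setIntegral_eq_integral_of_forall_compl_eq_zero fun y hy => by simp [hout y hy]]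
  have hA2 : ‖∫ y in A, η y • k y ∂ν‖ ≤ ∫ y in A, ‖k y‖ ∂ν := by
    refine norm_integral_le_of_norm_le hk.norm.integrableOn (Eventually.of_forall fun y => ?_)
    rw [norm_smul, Real.norm_of_nonneg (h0 y)]
    exact mul_le_of_le_one_left (norm_nonneg _) (h1 y)
  have : ∫ y in Metric.closedBall x r, k y ∂ν = V - ∫ y in A, η y • k y ∂ν := by
    rw [hsplit]; abel
  rw [this]
  exact (norm_sub_le _ _).trans (add_le_add hV hA2)

theorem integrable_mul_of_locallyIntegrable (hw : LocallyIntegrable w) {f : Plane → ℝ}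
    (hf : Continuous f) (hc : HasCompactSupport f) : Integrable fun x => w x * f x := by
  have := hw.integrable_smul_left_of_hasCompactSupport hf hc
  simpa [mul_comm] using this

/-- The product of `w` with a cutoff function has bounded variation. -/
theorem HasGradDensity.gradBound_cutoff (h : HasGradDensity w ν k) (hw : LocallyIntegrable w)
    (hk : Integrable k ν) {c : ℝ} (hc : 0 ≤ c) {x : Plane} {r s : ℝ} {η : Plane → ℝ}
    (hη : ContDiff ℝ ∞ η) (hηc : HasCompactSupport η) (h0 : ∀ y, 0 ≤ η y) (h1 : ∀ y, η y ≤ 1)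
    (hout : ∀ y ∉ Metric.closedBall x s, η y = 0)
    (hd : ∀ y, ‖fderiv ℝ η y‖ ≤
        (Metric.closedBall x s \ Metric.closedBall x r).indicator (fun _ => c) y) :
    GradBound (fun y => w y * η y) ((ν.restrict (Metric.closedBall x s)).withDensity (fun y => ‖k y‖ₑ) +
      (volume.restrict (Metric.closedBall x s \ Metric.closedBall x r)).withDensity
        (fun y => ENNReal.ofReal c * ‖w y‖ₑ)) := by
  set A := Metric.closedBall x s \ Metric.closedBall x r with hA
  have hBm : MeasurableSet (Metric.closedBall x s) := Metric.isClosed_closedBall.measurableSet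
  intro φ hφ hφc v
  obtain ⟨M, hM⟩ := hφ.continuous.bounded_above_of_compact_support hφc
  have hwA : AEMeasurable (fun y => ENNReal.ofReal c * ‖w y‖ₑ) (volume.restrict A) :=
    (hw.aestronglyMeasurable.restrict.enorm).const_mul _
  have e1 : ∫ y, |φ y| ∂((ν.restrict (Metric.closedBall x s)).withDensity fun y => ‖k y‖ₑ) =
      ∫ y in Metric.closedBall x s, |φ y| * ‖k y‖ ∂ν := by
    rw [integral_withDensity_eq_integral_toReal_smul₀ hk.1.restrict.enorm (by simp)]
    simp [mul_comm]
  have e2 : ∫ y, |φ y| ∂((volume.restrict A).withDensity fun y => ENNReal.ofReal c * ‖w y‖ₑ) =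
      c * ∫ y in A, |φ y| * |w y| := by
    rw [integral_withDensity_eq_integral_toReal_smul₀ hwA
      (Eventually.of_forall fun y => ENNReal.mul_lt_top ENNReal.ofReal_lt_top enorm_lt_top),
      ← integral_const_mul]
    refine integral_congr_ae (Eventually.of_forall fun y => ?_)
    simp [ENNReal.toReal_ofReal hc]
    ring
  have i1 : Integrable (fun y => |φ y|)
      ((ν.restrict (Metric.closedBall x s)).withDensity fun y => ‖k y‖ₑ) := by
    have : IsFiniteMeasure ((ν.restrict (Metric.closedBall x s)).withDensity fun y => ‖k y‖ₑ) :=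
      isFiniteMeasure_withDensity hk.integrableOn.2.ne
    exact (integrable_of_smooth hφ hφc _).abs
  have i2 : Integrable (fun y => |φ y|)
      ((volume.restrict A).withDensity fun y => ENNReal.ofReal c * ‖w y‖ₑ) := by
    have : IsFiniteMeasure ((volume.restrict A).withDensity fun y => ENNReal.ofReal c * ‖w y‖ₑ) := by
      refine isFiniteMeasure_withDensity ?_
      rw [lintegral_const_mul' _ _ ENNReal.ofReal_ne_top]
      refine ENNReal.mul_ne_top ENNReal.ofReal_ne_top ?_
      have := (integrableOn_annulus_abs hw x r s).2.ne
      simpa using this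
    exact (integrable_of_smooth hφ hφc _).abs
  rw [integral_add_measure i1 i2, e1, e2, mul_add]
  have hprod : ∀ y, fderiv ℝ (fun z => η z * φ z) y v = η y * fderiv ℝ φ y v + φ y * fderiv ℝ η y v := by
    intro y
    rw [fderiv_fun_mul (hη.differentiable (by simp) y) (hφ.differentiable (by simp) y)]
    simp
  have i3 : Integrable fun y => w y * fderiv ℝ (fun z => η z * φ z) y v :=
    integrable_mul_of_locallyIntegrable hw (continuous_fderiv_apply_of_smooth (hη.mul hφ) v)
      ((hηc.mul_right).fderiv_apply ℝ v)
  have i4 : Integrable fun y => w y * (φ y * fderiv ℝ η y v) :=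
    integrable_mul_of_locallyIntegrable hw
      (hφ.continuous.mul (continuous_fderiv_apply_of_smooth hη v)) hφc.mul_right
  have e3 : ∫ y, w y * η y * fderiv ℝ φ y v =
      -(∫ y, η y * φ y * inner ℝ (k y) v ∂ν) - ∫ y, w y * (φ y * fderiv ℝ η y v) := by
    rw [← h _ (hη.mul hφ) hηc.mul_right v, ← integral_sub i3 i4]
    refine integral_congr_ae (Eventually.of_forall fun y => ?_)
    simp only [hprod]
    ring
  have b1 : |∫ y, η y * φ y * inner ℝ (k y) v ∂ν| ≤
      ‖v‖ * ∫ y in Metric.closedBall x s, |φ y| * ‖k y‖ ∂ν := by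
    rw [← integral_const_mul, ← integral_indicator hBm]
    refine norm_integral_le_of_norm_le (f := fun y => η y * φ y * inner ℝ (k y) v) ?_
      (Eventually.of_forall fun y => ?_)
    · refine (integrable_indicator_iff hBm).2 (Integrable.const_mul ?_ _)
      refine (hk.norm.integrableOn.mul_bdd (c := M) hφ.continuous.norm.aestronglyMeasurable
        (Eventually.of_forall fun y => by simpa using hM y)).congr (Eventually.of_forall fun y => ?_)
      simp [mul_comm]
    · by_cases hy : y ∈ Metric.closedBall x s
      · rw [indicator_of_mem hy, norm_mul, norm_mul, Real.norm_of_nonneg (h0 y)]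
        calc η y * ‖φ y‖ * ‖inner ℝ (k y) v‖ ≤ 1 * ‖φ y‖ * (‖k y‖ * ‖v‖) := by
              gcongr
              · exact h1 y
              · exact norm_inner_le_norm _ _
          _ = _ := by rw [Real.norm_eq_abs]; ring
      · simp [hy, hout y hy]
  have b2 := abs_integral_mul_fderiv_le hw v hφ.continuous hd
  rw [e3]
  refine (abs_sub _ _).trans ?_
  rw [abs_neg]
  exact add_le_add b1 b2

/-- Sobolev is applied to `w η`, whose variation consists of `|k|` on the outer ball and of `|w|
|∇η|` on the annulus. The hypothesis `|w| ≤ w²` turns the resulting `L²` bound into a bound of the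
`L¹` norm by a square. -/
theorem HasGradDensity.integral_abs_le_sq (h : HasGradDensity w ν k) (hw : LocallyIntegrable w)
    (hk : Integrable k ν) (hint : ∀ y, |w y| ≤ w y ^ 2) {K : ℝ≥0∞} (hK : K ≠ ⊤)
    (hsob : ∀ (u : Plane → ℝ) (ν : Measure Plane),
      IsFiniteMeasure ν → Integrable u → HasCompactSupport u → GradBound u ν →
      eLpNorm u 2 volume ≤ K * ν univ)
    {c : ℝ} (hc : 0 ≤ c) {x : Plane} {r s : ℝ} {η : Plane → ℝ}
    (hη : ContDiff ℝ ∞ η) (hηc : HasCompactSupport η) (h0 : ∀ y, 0 ≤ η y) (h1 : ∀ y, η y ≤ 1)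
    (hin : ∀ y ∈ Metric.closedBall x r, η y = 1)
    (hout : ∀ y ∉ Metric.closedBall x s, η y = 0)
    (hd : ∀ y, ‖fderiv ℝ η y‖ ≤
        (Metric.closedBall x s \ Metric.closedBall x r).indicator (fun _ => c) y) :
    ∫ y in Metric.closedBall x r, |w y| ≤ (K.toReal * ((∫ y in Metric.closedBall x s, ‖k y‖ ∂ν) +
      c * ∫ y in Metric.closedBall x s \ Metric.closedBall x r, |w y|)) ^ 2 := by
  have hg := h.gradBound_cutoff hw hk hc hη hηc h0 h1 hout hd
  set A := Metric.closedBall x s \ Metric.closedBall x r with hA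
  have hwA := integrableOn_annulus_abs hw x r s
  have m1 : ((ν.restrict (Metric.closedBall x s)).withDensity fun y => ‖k y‖ₑ) univ =
      ENNReal.ofReal (∫ y in Metric.closedBall x s, ‖k y‖ ∂ν) := by
    rw [withDensity_apply _ .univ, Measure.restrict_univ,
      ofReal_integral_norm_eq_lintegral_enorm hk.integrableOn]
  have m2 : ((volume.restrict A).withDensity fun y => ENNReal.ofReal c * ‖w y‖ₑ) univ =
      ENNReal.ofReal (c * ∫ y in A, |w y|) := by
    rw [withDensity_apply _ .univ, Measure.restrict_univ, lintegral_const_mul' _ _ ENNReal.ofReal_ne_top,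
      ENNReal.ofReal_mul hc]
    congr 1
    have := ofReal_integral_norm_eq_lintegral_enorm hwA
    simpa using this.symm
  set μ := (ν.restrict (Metric.closedBall x s)).withDensity (fun y => ‖k y‖ₑ) +
      (volume.restrict A).withDensity (fun y => ENNReal.ofReal c * ‖w y‖ₑ) with hμ
  have p1 : 0 ≤ ∫ y in Metric.closedBall x s, ‖k y‖ ∂ν := integral_nonneg fun _ => norm_nonneg _
  have p2 : 0 ≤ c * ∫ y in A, |w y| := mul_nonneg hc (integral_nonneg fun _ => abs_nonneg _)
  have hμu : μ univ = ENNReal.ofReal ((∫ y in Metric.closedBall x s, ‖k y‖ ∂ν) +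
      c * ∫ y in A, |w y|) := by
    rw [hμ, Measure.add_apply, m1, m2, ENNReal.ofReal_add p1 p2]
  have hfin : IsFiniteMeasure μ := ⟨by rw [hμu]; exact ENNReal.ofReal_lt_top⟩
  have hsob' := hsob (fun y => w y * η y) μ hfin
    (integrable_mul_of_locallyIntegrable hw hη.continuous hηc) hηc.mul_left hg
  rw [hμu, ← ENNReal.ofReal_toReal hK, ← ENNReal.ofReal_mul ENNReal.toReal_nonneg] at hsob'
  have e1 : ENNReal.ofReal (∫ y in Metric.closedBall x r, |w y|) ≤
      eLpNorm (fun y => w y * η y) 2 volume ^ (2 : ℝ) := by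
    have e2 := eLpNorm_nnreal_pow_eq_lintegral (μ := (volume : Measure Plane)) (p := 2)
      (f := fun y => w y * η y) two_ne_zero
    simp only [NNReal.coe_ofNat, ENNReal.coe_ofNat] at e2
    have hwi := (locallyIntegrable_abs hw).integrableOn_isCompact (isCompact_closedBall x r)
    have e3 := ofReal_integral_norm_eq_lintegral_enorm hwi
    simp only [Real.norm_eq_abs, abs_abs] at e3
    rw [e2, e3, ← lintegral_indicator Metric.isClosed_closedBall.measurableSet]
    refine lintegral_mono fun y => ?_
    by_cases hy : y ∈ Metric.closedBall x r
    · rw [indicator_of_mem hy, hin y hy, mul_one, ENNReal.rpow_ofNat, ← enorm_pow, ← ofReal_norm, ← ofReal_norm]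
      refine ENNReal.ofReal_le_ofReal ?_
      simp only [Real.norm_eq_abs, abs_abs, abs_pow, sq_abs]
      exact hint y
    · rw [indicator_of_notMem hy]
      exact bot_le
  have e4 := e1.trans (ENNReal.rpow_le_rpow hsob' (by norm_num : (0 : ℝ) ≤ 2))
  rw [ENNReal.rpow_ofNat, ← ENNReal.ofReal_pow (by positivity)] at e4
  exact (ENNReal.ofReal_le_ofReal_iff (by positivity)).1 e4

theorem tendsto_setIntegral_closedBall {E : Type*} [NormedAddCommGroup E] [NormedSpace ℝ E]
    {μ : Measure Plane} {f : Plane → E} (hf : LocallyIntegrable f μ) (x : Plane) {r : ℝ}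
    {l : Filter ℝ} [l.IsCountablyGenerated] (hl : l ≤ 𝓝 r)
    (h : ∀ᵐ y ∂μ, ∀ᶠ t in l, (y ∈ Metric.closedBall x t ↔ y ∈ Metric.closedBall x r)) :
    Tendsto (fun t => ∫ y in Metric.closedBall x t, f y ∂μ) l
      (𝓝 (∫ y in Metric.closedBall x r, f y ∂μ)) := by
  have hm : ∀ t, MeasurableSet (Metric.closedBall x t) :=
    fun t => Metric.isClosed_closedBall.measurableSet
  simp only [← integral_indicator (hm _)]
  have hfi := hf.integrableOn_isCompact (isCompact_closedBall x (r + 1))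
  refine tendsto_integral_filter_of_dominated_convergence
    ((Metric.closedBall x (r + 1)).indicator fun y => ‖f y‖) ?_ ?_ ?_ ?_
  · refine Eventually.of_forall fun t => ?_
    exact (hf.integrableOn_isCompact (isCompact_closedBall x t)).1.indicator (hm t) |> fun _ =>
      (aestronglyMeasurable_indicator_iff (hm t)).2
        (hf.integrableOn_isCompact (isCompact_closedBall x t)).1
  · have : ∀ᶠ t in l, t < r + 1 := hl (gt_mem_nhds (by linarith))
    filter_upwards [this] with t ht
    refine Eventually.of_forall fun y => ?_
    rw [norm_indicator_eq_indicator_norm]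
    exact indicator_le_indicator_of_subset (Metric.closedBall_subset_closedBall ht.le)
      (fun _ => norm_nonneg _) y
  · exact (integrable_indicator_iff (hm _)).2 hfi.norm
  · filter_upwards [h] with y hy
    refine tendsto_const_nhds.congr' ?_
    filter_upwards [hy] with t ht
    by_cases hyr : y ∈ Metric.closedBall x r
    · rw [indicator_of_mem hyr, indicator_of_mem (ht.2 hyr)]
    · rw [indicator_of_notMem hyr, indicator_of_notMem fun h => hyr (ht.1 h)]

theorem tendsto_setIntegral_closedBall_right {E : Type*} [NormedAddCommGroup E] [NormedSpace ℝ E]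
    {μ : Measure Plane} {f : Plane → E} (hf : LocallyIntegrable f μ) (x : Plane) (r : ℝ) :
    Tendsto (fun t => ∫ y in Metric.closedBall x t, f y ∂μ) (𝓝[>] r)
      (𝓝 (∫ y in Metric.closedBall x r, f y ∂μ)) := by
  refine tendsto_setIntegral_closedBall hf x nhdsWithin_le_nhds (Eventually.of_forall fun y => ?_)
  simp only [Metric.mem_closedBall]
  rcases le_or_gt (dist y x) r with hy | hy
  · filter_upwards [self_mem_nhdsWithin] with t ht
    simp only [hy, iff_true]
    exact hy.trans (le_of_lt ht)
  · filter_upwards [nhdsWithin_le_nhds (gt_mem_nhds hy)] with t ht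
    constructor <;> intro <;> linarith

/-- Spheres are Lebesgue null, so continuity is two-sided; for a general measure closed balls only
give continuity from the right. -/
theorem continuous_setIntegral_closedBall {f : Plane → ℝ} (hf : LocallyIntegrable f) (x : Plane) :
    ContinuousOn (fun t => ∫ y in Metric.closedBall x t, f y) (Ioi 0) := by
  intro r hr
  refine ContinuousAt.continuousWithinAt (tendsto_setIntegral_closedBall hf x le_rfl ?_)
  have hs : ∀ᵐ y : Plane, y ∉ Metric.sphere x r :=
    measure_eq_zero_iff_ae_notMem.1 (Measure.addHaar_sphere _ x r)
  filter_upwards [hs] with y hy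
  simp only [Metric.mem_closedBall, Metric.mem_sphere] at hy ⊢
  rcases lt_or_gt_of_ne hy with h | h
  · filter_upwards [lt_mem_nhds h] with t ht
    constructor <;> intro <;> linarith
  · filter_upwards [gt_mem_nhds h] with t ht
    constructor <;> intro <;> linarith

end Density

end PlanarSteiner

/-! ### Quadratic growth and the absence of a Cantor part. -/

namespace PlanarSteiner

/-- Around a point which is seen by the gradient, the `L¹` norm of a function with `|w| ≤ w²` on
balls is bounded below by a multiple of the area. -/
theorem HasGradDensity.exists_growth {w : Plane → ℝ} {ν : Measure Plane} {k : Plane → Plane}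
    (h : HasGradDensity w ν k) (hw : LocallyIntegrable w)
    (hk : Integrable k ν) (hint : ∀ y, |w y| ≤ w y ^ 2) {x : Plane} {R : ℝ}
    (hR : ∀ r ∈ Ioo 0 R, 0 < ∫ y in Metric.closedBall x r, ‖k y‖ ∂ν ∧
      ∫ y in Metric.closedBall x r, ‖k y‖ ∂ν ≤ 2 * ‖∫ y in Metric.closedBall x r, k y ∂ν‖) :
    ∃ c > 0, ∀ r ∈ Ioo 0 R, (c * r) ^ 2 ≤ ∫ y in Metric.closedBall x r, |w y| := by
  obtain ⟨K, hK, hsob⟩ := exists_sobolev_const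
  obtain ⟨C, hC, hcut⟩ := exists_cutoff
  set m : ℝ → ℝ := fun r => ∫ y in Metric.closedBall x r, |w y| with hm
  set d : ℝ → ℝ := fun r => ∫ y in Metric.closedBall x r, ‖k y‖ ∂ν with hd
  have hwl := locallyIntegrable_abs hw
  have hmono : ∀ {r s : ℝ}, r ≤ s → m r ≤ m s := fun {r s} hrs =>
    setIntegral_mono_set (hwl.integrableOn_isCompact (isCompact_closedBall x s))
      (Eventually.of_forall fun _ => abs_nonneg _)
      (Metric.closedBall_subset_closedBall hrs).eventuallyLE
  have hm0 : ∀ r, 0 ≤ m r := fun r => integral_nonneg fun _ => abs_nonneg _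
  have hA : ∀ r > 0, ∀ δ > 0, ‖∫ y in Metric.closedBall x r, k y ∂ν‖ ≤
      C / δ * (m (r + δ) - m r) + (d (r + δ) - d r) := by
    intro r hr δ hδ
    obtain ⟨η, g1, g2, g3, g4, g5, g6, g7⟩ := hcut x r δ hr hδ
    exact h.norm_setIntegral_le hw hk hδ g1 g2 g3 g4 g5 g6 g7
  have hB : ∀ r > 0, ∀ δ > 0, m r ≤ (K.toReal * (d (r + δ) + C / δ * (m (r + δ) - m r))) ^ 2 := by
    intro r hr δ hδ
    obtain ⟨η, g1, g2, g3, g4, g5, g6, g7⟩ := hcut x r δ hr hδ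
    have := h.integral_abs_le_sq hw hk hint hK hsob (by positivity) g1 g2 g3 g4 g5 g6 g7
    rwa [setIntegral_annulus hwl x hδ] at this
  have hdt : ∀ r, Tendsto (fun t => d t - d r) (𝓝[>] r) (𝓝 0) := fun r => by
    have := (tendsto_setIntegral_closedBall_right hk.norm.locallyIntegrable x r).sub_const (d r)
    rwa [sub_self] at this
  -- If `m r = 0`, then `w` vanishes almost everywhere near the ball of radius `r/2`, so `hA` and
  -- right continuity of `d` give zero gradient mass there, against `hR`.
  have hpos : ∀ r ∈ Ioo 0 R, 0 < m r := by
    intro r hr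
    refine (hm0 r).lt_of_ne fun h0 => ?_
    have hr' : r / 2 ∈ Ioo 0 R := ⟨by linarith [hr.1], by linarith [hr.1, hr.2]⟩
    have h1 : ‖∫ y in Metric.closedBall x (r / 2), k y ∂ν‖ ≤ 0 := by
      refine ge_of_tendsto (hdt (r / 2)) ?_
      filter_upwards [Ioo_mem_nhdsGT (show r / 2 < r by linarith [hr.1])] with t ht
      have h2 := hA (r / 2) hr'.1 (t - r / 2) (by linarith [ht.1])
      rw [add_sub_cancel] at h2
      have h3 : m t = 0 := le_antisymm (h0 ▸ hmono ht.2.le) (hm0 t)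
      have h4 : m (r / 2) = 0 := le_antisymm (h0 ▸ hmono (by linarith [hr.1])) (hm0 _)
      rw [h3, h4] at h2
      simpa using h2
    have h5 := hR _ hr'
    linarith [h5.1, h5.2]
  -- Adding `1` makes the constant positive even if the Sobolev constant vanishes.
  set K0 : ℝ := K.toReal + 1 with hK0
  have hK0p : 0 < K0 := by positivity
  have hc0 : 0 < 1 / (3 * K0 * C) := by positivity
  refine ⟨1 / (3 * K0 * C) / 8, by positivity, fun r hr => ?_⟩
  refine sq_le_of_sqrt_le_slope hc0
    ((continuous_setIntegral_closedBall hwl x).mono fun t ht => ht.1) hpos ?_ hr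
  -- Up to increments of `d`, which vanish from the right, `hA` and `hR` give `d ≤ 2 C q` for the
  -- difference quotient `q` of `m`. Then `hB` gives `√m ≤ 3 K0 C q`, which explains the constant.
  intro r hr a ha
  have h1 := (hdt r).eventually
    (gt_mem_nhds (show (0 : ℝ) < C * (1 / (3 * K0 * C) * √(m r) - a) from
      mul_pos hC (by linarith)))
  filter_upwards [h1, self_mem_nhdsWithin] with t ht htr
  have htr : r < t := htr
  have hδ : 0 < t - r := by linarith
  have hA1 := hA r hr.1 (t - r) hδ
  have hB1 := hB r hr.1 (t - r) hδ
  rw [add_sub_cancel] at hA1 hB1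
  have h3 := (hR r hr).2
  rw [slope_def_field]
  set q := (m t - m r) / (t - r) with hq
  have hq' : C / (t - r) * (m t - m r) = C * q := by rw [hq]; ring
  rw [hq'] at hA1 hB1
  have hq0 : 0 ≤ q := div_nonneg (by linarith [hmono htr.le]) hδ.le
  have hd0 : 0 ≤ d t := integral_nonneg fun _ => norm_nonneg _
  have hsq : √(m r) ≤ K.toReal * (d t + C * q) := by
    rw [← Real.sqrt_sq (show 0 ≤ K.toReal * (d t + C * q) by positivity)]
    exact Real.sqrt_le_sqrt hB1
  have h4 : √(m r) ≤ K0 * (3 * (C * q) + 3 * (d t - d r)) := by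
    refine hsq.trans ?_
    have : d t + C * q ≤ 3 * (C * q) + 3 * (d t - d r) := by
      simp only [hd] at *
      linarith
    calc K.toReal * (d t + C * q) ≤ K0 * (d t + C * q) :=
          mul_le_mul_of_nonneg_right (by linarith) (by positivity)
      _ ≤ _ := mul_le_mul_of_nonneg_left this hK0p.le
  have h5 : C * (1 / (3 * K0 * C) * √(m r)) ≤ C * q + (d t - d r) := by
    have : C * (1 / (3 * K0 * C) * √(m r)) = √(m r) / (3 * K0) := by field_simp
    rw [this, div_le_iff₀ (by positivity)]
    linarith
  have h6 : C * a < C * q := by linarith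
  exact lt_of_mul_lt_mul_left h6 hC.le

/-- `round z` is at least as close to `z` as `n` is. Real limits can thus be replaced with integers
at the cost of a factor `2`. -/
theorem abs_sub_round_le_two_mul (n : ℤ) (z : ℝ) : |(n : ℝ) - round z| ≤ 2 * |(n : ℝ) - z| := by
  have h1 := round_le z n
  have h2 := abs_sub_le (n : ℝ) z (round z)
  rw [abs_sub_comm z n] at h1
  linarith

/-- Integer valued functions of bounded variation have no Cantor part. -/
theorem MemBV.memSBV_of_int {u : Plane → ℤ} (hu : MemBV fun x => (u x : ℝ)) :
    MemSBV fun x => (u x : ℝ) := by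
  obtain ⟨ν, k, hν, hk, hD⟩ := exists_eq_withDensityᵥ (distribGradient fun x => (u x : ℝ))
  have hgrad := hu.isDistribGradient
  rw [hD] at hgrad
  -- All of `Du` is concentrated on the approximate discontinuity set: at a good point with
  -- approximate limit `z`, the growth estimate for `u - round z` contradicts the decay of the
  -- averages of `|u - z|`.
  have key : ∀ᵐ x ∂ν, k x = 0 ∨ x ∈ approxDiscSet fun x => (u x : ℝ) := by
    filter_upwards [ae_integral_norm_le_two_mul hk] with x hx
    by_contra! hcon
    obtain ⟨hkx, hS⟩ := hcon
    obtain ⟨R, hR0, hR⟩ := hx hkx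
    simp only [approxDiscSet, mem_ofPred_eq, not_not] at hS
    obtain ⟨z, hz⟩ := hS
    have hloc : ∀ c : ℝ, LocallyIntegrable fun y => (u y : ℝ) - c := fun c =>
      hu.integrable.locallyIntegrable.sub (locallyIntegrable_const c)
    have hint : ∀ y, |(u y : ℝ) - (round z : ℤ)| ≤ ((u y : ℝ) - (round z : ℤ)) ^ 2 := by
      intro y
      rw [← Int.cast_sub, ← sq_abs]
      rcases eq_or_ne (u y - round z) 0 with h | h
      · simp [h]
      · have : (1 : ℝ) ≤ |((u y - round z : ℤ) : ℝ)| := by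
          exact_mod_cast Int.one_le_abs h
        nlinarith
    obtain ⟨c, hc, hgrow⟩ := (IsDistribGradient.hasGradDensity hu.integrable hk hgrad
      (round z : ℤ)).exists_growth (hloc _) hk hint hR
    set V : ℝ := volume.real (Metric.ball (0 : Plane) 1) with hV
    have hVp : 0 < V := ENNReal.toReal_pos (Metric.measure_ball_pos _ _ one_pos).ne'
      measure_ball_lt_top.ne
    -- Growth on the ball of radius `ρ/2` gives `c² ρ² / 4`; rounding costs a factor `2`, and the
    -- ball of radius `ρ` has area `ρ² V`.
    have hlow : ∀ᶠ ρ in 𝓝[>] (0 : ℝ), c ^ 2 / (8 * V) ≤ ⨍ y in Metric.ball x ρ, |(u y : ℝ) - z| := by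
      filter_upwards [Ioo_mem_nhdsGT hR0] with ρ hρ
      have hvol : volume.real (Metric.ball x ρ) = ρ ^ 2 * V := by
        rw [measureReal_def, Measure.addHaar_ball _ _ hρ.1.le, ENNReal.toReal_mul,
          ENNReal.toReal_ofReal (pow_nonneg hρ.1.le _), finrank_euclideanSpace_fin, hV, measureReal_def]
      rw [setAverage_eq, hvol, smul_eq_mul, inv_mul_eq_div,
        le_div_iff₀ (mul_pos (pow_pos hρ.1 2) hVp)]
      have h1 := hgrow (ρ / 2) ⟨by linarith [hρ.1], by linarith [hρ.1, hρ.2]⟩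
      have hiz : IntegrableOn (fun y => |(u y : ℝ) - z|) (Metric.ball x ρ) :=
        ((locallyIntegrable_abs (hloc z)).integrableOn_isCompact
          (isCompact_closedBall x ρ)).mono_set Metric.ball_subset_closedBall
      have h2 : ∫ y in Metric.closedBall x (ρ / 2), |(u y : ℝ) - (round z : ℤ)| ≤
          ∫ y in Metric.ball x ρ, 2 * |(u y : ℝ) - z| := by
        have hsub : Metric.closedBall x (ρ / 2) ⊆ Metric.ball x ρ :=
          Metric.closedBall_subset_ball (by linarith [hρ.1])
        refine (setIntegral_mono ((locallyIntegrable_abs (hloc _)).integrableOn_isCompact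
          (isCompact_closedBall x _)) ((hiz.mono_set hsub).const_mul 2)
          fun y => abs_sub_round_le_two_mul (u y) z).trans ?_
        exact setIntegral_mono_set (hiz.const_mul 2) (Eventually.of_forall fun y => by positivity)
          hsub.eventuallyLE
      rw [integral_const_mul] at h2
      have h3 : c ^ 2 / (8 * V) * (ρ ^ 2 * V) = (c * (ρ / 2)) ^ 2 / 2 := by field_simp; ring
      rw [h3]
      linarith
    have h4 := ge_of_tendsto hz hlow
    have : 0 < c ^ 2 / (8 * V) := by positivity
    linarith
  refine ⟨hu, fun B hB _ hdisj => ?_⟩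
  rw [hD, withDensityᵥ_apply hk hB]
  refine setIntegral_eq_zero_of_ae_eq_zero ?_
  filter_upwards [key] with x hx hxB
  exact hx.resolve_right fun h => Set.disjoint_left.1 hdisj hxB h

end PlanarSteiner

/-! ### Bounded test fields and a bounded contraction of the line. -/

namespace PlanarSteiner

theorem curl_smul {φ : Plane → ℝ} {w : Plane → Plane} (hφ : ContDiff ℝ ∞ φ) (hw : ContDiff ℝ ∞ w)
    (x : Plane) : curl (fun y => φ y • w y) x = φ x * curl w x +
      (fderiv ℝ φ x (EuclideanSpace.single 0 1) * w x 1 -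
        fderiv ℝ φ x (EuclideanSpace.single 1 1) * w x 0) := by
  rw [curl, fderiv_fun_smul (hφ.differentiable (by simp) x) (hw.differentiable (by simp) x), curl]
  simp
  ring

theorem continuous_curl {w : Plane → Plane} (hw : ContDiff ℝ ∞ w) : Continuous (curl w) :=
  ((EuclideanSpace.proj 1 : Plane →L[ℝ] ℝ).continuous.comp
    (continuous_fderiv_apply_of_smooth hw _)).sub
  ((EuclideanSpace.proj 0 : Plane →L[ℝ] ℝ).continuous.comp
    (continuous_fderiv_apply_of_smooth hw _))

theorem hasCompactSupport_curl {w : Plane → Plane} (hw : HasCompactSupport w) :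
    HasCompactSupport (curl w) :=
  (hasCompactSupport_coord (hw.fderiv_apply ℝ (EuclideanSpace.single 0 1)) 1).sub
    (hasCompactSupport_coord (hw.fderiv_apply ℝ (EuclideanSpace.single 1 1)) 0)

/-- Compactly supported fields may be replaced with bounded fields of bounded curl. -/
theorem CurlDominated.of_bounded {u : Plane → ℝ} {l κ : Measure Plane} {τ : Plane}
    [IsFiniteMeasure l] [IsFiniteMeasure κ] (h : CurlDominated u l τ κ) (hu : Integrable u)
    {w : Plane → Plane} (hw : ContDiff ℝ ∞ w) {B B' : ℝ} (hB : ∀ x, ‖w x‖ ≤ B)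
    (hB' : ∀ x, |curl w x| ≤ B') :
    |(∫ x, u x * curl w x) + ∫ x, inner ℝ τ (w x) ∂l| ≤ ∫ x, ‖w x‖ ∂κ := by
  obtain ⟨C, hC, hcut⟩ := exists_cutoff
  -- Transition layers of fixed width `1` keep the gradients bounded by `C` for all `n`, so
  -- dominated convergence applies.
  choose η g1 g2 g3 g4 g5 g6 g7 using fun n : ℕ => hcut 0 (n + 1) 1 (by positivity) one_pos
  have hB0 : 0 ≤ B := (norm_nonneg _).trans (hB 0)
  have hin : ∀ x : Plane, ∀ᶠ n : ℕ in atTop, x ∈ Metric.closedBall (0 : Plane) (n + 1) := by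
    intro x
    obtain ⟨N, hN⟩ := exists_nat_ge ‖x‖
    filter_upwards [eventually_ge_atTop N] with n hn
    rw [mem_closedBall_zero_iff]
    have : (N : ℝ) ≤ n := by exact_mod_cast hn
    linarith
  have hd : ∀ n x, ‖fderiv ℝ (η n) x‖ ≤ C := fun n x =>
    (g7 n x).trans (by rw [div_one]; exact indicator_le_self' (fun _ _ => hC.le) x)
  have hbd : ∀ n x, |curl (fun y => η n y • w y) x| ≤ B' + 2 * (C * B) := by
    intro n x
    rw [curl_smul (g1 n) hw]
    have e1 : |η n x * curl w x| ≤ B' := by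
      rw [abs_mul, abs_of_nonneg (g3 n x)]
      exact (mul_le_of_le_one_left (abs_nonneg _) (g4 n x)).trans (hB' x)
    have e2 : ∀ i j : Fin 2, |fderiv ℝ (η n) x (EuclideanSpace.single i 1) * w x j| ≤ C * B := by
      intro i j
      rw [abs_mul]
      refine mul_le_mul ?_ ((PiLp.norm_apply_le (w x) j).trans (hB x)) (abs_nonneg _) hC.le
      refine ((fderiv ℝ (η n) x).le_opNorm _).trans ?_
      simpa using hd n x
    calc _ ≤ |η n x * curl w x| + |fderiv ℝ (η n) x (EuclideanSpace.single 0 1) * w x 1 -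
          fderiv ℝ (η n) x (EuclideanSpace.single 1 1) * w x 0| := abs_add_le _ _
      _ ≤ B' + (C * B + C * B) := add_le_add e1 ((abs_sub _ _).trans (add_le_add (e2 _ _) (e2 _ _)))
      _ = _ := by ring
  have hpt : ∀ x, ∀ᶠ n in atTop, curl (fun y => η n y • w y) x = curl w x := by
    intro x
    filter_upwards [hin x] with n hn
    have : fderiv ℝ (η n) x = 0 := by
      have := g7 n x
      rw [indicator_of_notMem (fun h => h.2 hn)] at this
      exact norm_le_zero_iff.1 this
    rw [curl_smul (g1 n) hw, this, g5 n x hn]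
    simp
  have t1 : Tendsto (fun n => ∫ x, u x * curl (fun y => η n y • w y) x) atTop
      (𝓝 (∫ x, u x * curl w x)) := by
    refine tendsto_integral_of_dominated_convergence (fun x => |u x| * (B' + 2 * (C * B)))
      (fun n => hu.1.mul (continuous_curl ((g1 n).smul hw)).aestronglyMeasurable)
      (hu.abs.mul_const _) (fun n => Eventually.of_forall fun x => ?_)
      (Eventually.of_forall fun x => ?_)
    · rw [Real.norm_eq_abs, abs_mul]
      exact mul_le_mul_of_nonneg_left (hbd n x) (abs_nonneg _)
    · refine tendsto_const_nhds.congr' ?_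
      filter_upwards [hpt x] with n hn
      rw [hn]
  have t2 : Tendsto (fun n => ∫ x, inner ℝ τ (η n x • w x) ∂l) atTop
      (𝓝 (∫ x, inner ℝ τ (w x) ∂l)) := by
    refine tendsto_integral_of_dominated_convergence (fun x => ‖τ‖ * B)
      (fun n => (continuous_const.inner ((g1 n).continuous.smul hw.continuous)).aestronglyMeasurable)
      (integrable_const _) (fun n => Eventually.of_forall fun x => ?_)
      (Eventually.of_forall fun x => ?_)
    · refine (norm_inner_le_norm _ _).trans (mul_le_mul_of_nonneg_left ?_ (norm_nonneg _))
      rw [norm_smul, Real.norm_of_nonneg (g3 n x)]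
      exact (mul_le_of_le_one_left (norm_nonneg _) (g4 n x)).trans (hB x)
    · refine tendsto_const_nhds.congr' ?_
      filter_upwards [hin x] with n hn
      rw [g5 n x hn, one_smul]
  refine le_of_tendsto (t1.add t2).abs (Eventually.of_forall fun n => ?_)
  have hwi : Integrable (fun x => ‖w x‖) κ :=
    Integrable.of_bound hw.continuous.norm.aestronglyMeasurable B
      (Eventually.of_forall fun x => by simpa using hB x)
  have hη : ∀ x, ‖η n x • w x‖ ≤ ‖w x‖ := fun x => by
    rw [norm_smul, Real.norm_of_nonneg (g3 n x)]
    exact mul_le_of_le_one_left (norm_nonneg _) (g4 n x)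
  refine (h _ ((g1 n).smul hw) (g2 n).smul_right).trans (integral_mono ?_ hwi hη)
  exact hwi.mono' ((g1 n).continuous.smul hw.continuous).norm.aestronglyMeasurable
    (Eventually.of_forall fun x => by simpa using hη x)

/-- A smooth bounded contraction of the line which is the identity on `[-M, M]`. -/
theorem exists_contraction {M : ℝ} (hM : 0 < M) : ∃ h g : ℝ → ℝ, ContDiff ℝ ∞ h ∧ ContDiff ℝ ∞ g ∧
    (∀ t, HasDerivAt h (g t) t) ∧ (∀ t, 0 < g t) ∧ (∀ t, g t ≤ 1) ∧
    (∀ t, |t| ≤ M → h t = t ∧ g t = 1) ∧ ∀ t, |h t| ≤ 7 * M := by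
  let ψ : ContDiffBump (0 : ℝ) := ⟨M, 3 / 2 * M, hM, by linarith⟩
  let p : ℝ → ℝ := fun t => (1 + (t / M) ^ 2)⁻¹
  have hp0 : ∀ t, 0 < p t := fun t => by positivity
  have hp1 : ∀ t, p t ≤ 1 := fun t => inv_le_one_of_one_le₀ (by nlinarith [sq_nonneg (t / M)])
  have hpc : ContDiff ℝ ∞ p :=
    (contDiff_const.add ((contDiff_id.div_const M).pow 2)).inv fun t => by positivity
  -- The tail `p` keeps `g` positive, hence `h` injective, with finite total integral; the bump
  -- lifts `g` to `1` on `[-M, M]`. The integral of `g` is at most `π M` from `p` plus `3 M` from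
  -- the support of the bump, so at most `7 M`.
  let g : ℝ → ℝ := fun t => p t + ψ t * (1 - p t)
  have hg : ContDiff ℝ ∞ g := hpc.add (ψ.contDiff.mul (contDiff_const.sub hpc))
  have hψ1 : ∀ t, |t| ≤ M → ψ t = 1 := fun t ht =>
    ψ.one_of_mem_closedBall (by simpa [ψ] using ht)
  have hg0 : ∀ t, 0 < g t := fun t =>
    add_pos_of_pos_of_nonneg (hp0 t) (mul_nonneg ψ.nonneg (by linarith [hp1 t]))
  have hg1 : ∀ t, g t ≤ 1 := fun t => by
    have := mul_le_of_le_one_left (sub_nonneg.2 (hp1 t)) (ψ.le_one (x := t))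
    simp only [g]; linarith
  have hgM : ∀ t, |t| ≤ M → g t = 1 := fun t ht => by simp only [g, hψ1 t ht]; ring
  have hh : ∀ t, HasDerivAt (fun t => ∫ s in (0 : ℝ)..t, g s) (g t) t := fun t =>
    intervalIntegral.integral_hasDerivAt_right (hg.continuous.intervalIntegrable _ _)
      (hg.continuous.stronglyMeasurableAtFilter _ _) hg.continuous.continuousAt
  refine ⟨fun t => ∫ s in (0 : ℝ)..t, g s, g, ?_, hg, hh, hg0, hg1, fun t ht => ⟨?_, hgM t ht⟩, ?_⟩
  · refine contDiff_infty_iff_deriv.2 ⟨fun t => (hh t).differentiableAt, ?_⟩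
    rwa [funext fun t => (hh t).deriv]
  · have : ∀ s ∈ uIcc 0 t, g s = 1 := fun s hs => hgM s ((by
      rcases le_total 0 t with h | h
      · rw [uIcc_of_le h] at hs
        exact abs_le_abs_of_nonneg hs.1 hs.2
      · rw [uIcc_of_ge h] at hs
        rw [abs_of_nonpos hs.2, abs_of_nonpos h]; linarith [hs.1] : |s| ≤ |t|).trans ht)
    simp [intervalIntegral.integral_congr this]
  · intro t
    have hpi : Integrable p := by
      have := integrable_inv_one_add_sq.comp_div hM.ne'
      exact this
    let I : Set ℝ := Icc (-(3 / 2 * M)) (3 / 2 * M)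
    have hI : Integrable (I.indicator fun _ => (1 : ℝ)) :=
      (integrable_indicator_iff measurableSet_Icc).2 (integrableOn_const (by simp))
    have hle : ∀ s, g s ≤ p s + I.indicator (fun _ => (1 : ℝ)) s := by
      intro s
      have h1 : ψ s * (1 - p s) ≤ ψ s := mul_le_of_le_one_right ψ.nonneg (by linarith [hp0 s])
      have h2 : ψ s ≤ I.indicator (fun _ => (1 : ℝ)) s := by
        by_cases hs : s ∈ I
        · rw [indicator_of_mem hs]; exact ψ.le_one
        · rw [indicator_of_notMem hs]
          refine (ψ.zero_of_le_dist ?_).le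
          rw [Real.dist_0_eq_abs]
          by_contra! hlt
          exact hs (abs_le.1 hlt.le)
      simp only [g]; linarith
    have hgi : Integrable g := (hpi.add hI).mono' hg.continuous.aestronglyMeasurable
      (Eventually.of_forall fun s => by rw [Real.norm_of_nonneg (hg0 s).le]; exact hle s)
    have e1 : ∫ s, p s = M * Real.pi := by
      have := Measure.integral_comp_div (fun s : ℝ => (1 + s ^ 2)⁻¹) M
      rw [integral_univ_inv_one_add_sq, abs_of_pos hM, smul_eq_mul] at this
      exact this
    have e2 : ∫ s, I.indicator (fun _ => (1 : ℝ)) s = 3 * M := by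
      rw [integral_indicator measurableSet_Icc]
      simp only [integral_const, measureReal_restrict_apply_univ, Real.volume_real_Icc, smul_eq_mul, mul_one]
      rw [max_eq_left (by linarith)]; ring
    rw [← Real.norm_eq_abs]
    calc ‖∫ s in (0 : ℝ)..t, g s‖ ≤ ∫ s in uIoc 0 t, ‖g s‖ :=
          intervalIntegral.norm_integral_le_integral_norm_uIoc
      _ ≤ ∫ s, ‖g s‖ := setIntegral_le_integral hgi.norm (Eventually.of_forall fun _ => norm_nonneg _)
      _ ≤ ∫ s, (p s + I.indicator (fun _ => (1 : ℝ)) s) := integral_mono hgi.norm (hpi.add hI)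
          fun s => by
            simp only [Real.norm_of_nonneg (hg0 s).le]; exact hle s
      _ = M * Real.pi + 3 * M := by rw [integral_add hpi hI, e1, e2]
      _ ≤ 7 * M := by nlinarith [Real.pi_lt_four]

end PlanarSteiner

/-! ### Pushing competitors into a ball. -/

namespace PlanarSteiner

/-- Apply a function to both coordinates. -/
def coordMap (h : ℝ → ℝ) (x : Plane) : Plane := !₂[h (x 0), h (x 1)]

theorem coordMap_apply (h : ℝ → ℝ) (x : Plane) (i : Fin 2) : coordMap h x i = h (x i) := by
  fin_cases i <;> simp [coordMap]

/-- The linear map with diagonal matrix `diag(a, b)`. -/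
def diagCLM (a b : ℝ) : Plane →L[ℝ] Plane := Matrix.toEuclideanCLM (𝕜 := ℝ) (Matrix.diagonal ![a, b])

theorem diagCLM_apply (a b : ℝ) (v : Plane) : diagCLM a b v = !₂[a * v 0, b * v 1] := by
  ext i
  fin_cases i <;>
    simp [diagCLM, Matrix.ofLp_toEuclideanCLM, Matrix.mulVec_diagonal]

theorem det_diagCLM (a b : ℝ) : (diagCLM a b).det = a * b := by
  rw [diagCLM, ContinuousLinearMap.det, Matrix.coe_toEuclideanCLM_eq_toEuclideanLin,
    Matrix.toEuclideanLin, Matrix.toLpLin_eq_toLin, LinearMap.det_toLin, Matrix.det_diagonal]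
  simp

section

variable {h g : ℝ → ℝ}

theorem hasFDerivAt_coordMap (hh : ∀ t, HasDerivAt h (g t) t) (x : Plane) :
    HasFDerivAt (coordMap h) (diagCLM (g (x 0)) (g (x 1))) x := by
  rw [← hasFDerivWithinAt_univ, hasFDerivWithinAt_euclidean]
  intro i
  rw [hasFDerivWithinAt_univ]
  have h1 := (hh (x i)).comp_hasFDerivAt x (EuclideanSpace.proj i : Plane →L[ℝ] ℝ).hasFDerivAt
  have h2 : (fun y => coordMap h y i) = h ∘ (EuclideanSpace.proj i : Plane →L[ℝ] ℝ) := by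
    funext y; simp [coordMap_apply]
  rw [h2]
  refine h1.congr_fderiv ?_
  ext v
  fin_cases i <;> simp [diagCLM_apply]

theorem contDiff_coordMap (hh : ContDiff ℝ ∞ h) : ContDiff ℝ ∞ (coordMap h) := by
  rw [contDiff_euclidean]
  intro i
  simp only [coordMap_apply]
  exact hh.comp (EuclideanSpace.proj i : Plane →L[ℝ] ℝ).contDiff

theorem injective_coordMap (hh : ∀ t, HasDerivAt h (g t) t) (hg : ∀ t, 0 < g t) :
    Function.Injective (coordMap h) := by
  have hmono : StrictMono h := strictMono_of_hasDerivAt_pos hh hg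
  intro x y hxy
  ext i
  have := congrArg (fun z : Plane => z i) hxy
  simp only [coordMap_apply] at this
  exact hmono.injective this

/-- `7 √2 < 9.9`, that is, `98 ≤ 98.01`. The gap between `9.9` and `10` later leaves room for the
closed support inside the open ball. -/
theorem norm_coordMap_le {C : ℝ} (hh : ∀ t, |h t| ≤ 7 * C) (x : Plane) (hC : 0 < C) :
    ‖coordMap h x‖ ≤ 99 / 10 * C := by
  rw [EuclideanSpace.norm_eq, Real.sqrt_le_left (by positivity)]
  simp only [coordMap_apply, Fin.sum_univ_two, Real.norm_eq_abs]
  have h0 := pow_le_pow_left₀ (abs_nonneg _) (hh (x 0)) 2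
  have h1 := pow_le_pow_left₀ (abs_nonneg _) (hh (x 1)) 2
  nlinarith

/-- The pull-back of a field (as a differential form) by `coordMap h`, where `g = h'`. -/
def pullback (h g : ℝ → ℝ) (w : Plane → Plane) (x : Plane) : Plane :=
  diagCLM (g (x 0)) (g (x 1)) (w (coordMap h x))

theorem pullback_apply (w : Plane → Plane) (x : Plane) (i : Fin 2) :
    pullback h g w x i = g (x i) * w (coordMap h x) i := by
  rw [pullback, diagCLM_apply]
  fin_cases i <;> simp

theorem contDiff_pullback (hh : ContDiff ℝ ∞ h) (hg : ContDiff ℝ ∞ g) {w : Plane → Plane}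
    (hw : ContDiff ℝ ∞ w) : ContDiff ℝ ∞ (pullback h g w) := by
  rw [contDiff_euclidean]
  intro i
  simp only [pullback_apply]
  exact (hg.comp (EuclideanSpace.proj i : Plane →L[ℝ] ℝ).contDiff).mul
    (contDiff_coord (hw.comp (contDiff_coordMap hh)) i)

theorem norm_pullback_le (hg0 : ∀ t, 0 < g t) (hg1 : ∀ t, g t ≤ 1) (w : Plane → Plane) (x : Plane) :
    ‖pullback h g w x‖ ≤ ‖w (coordMap h x)‖ := by
  rw [EuclideanSpace.norm_eq, EuclideanSpace.norm_eq]
  refine Real.sqrt_le_sqrt (Finset.sum_le_sum fun i _ => ?_)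
  rw [pullback_apply, norm_mul, Real.norm_of_nonneg (hg0 _).le]
  exact pow_le_pow_left₀ (mul_nonneg (hg0 _).le (norm_nonneg _))
    (mul_le_of_le_one_left (norm_nonneg _) (hg1 _)) 2

theorem curl_pullback (hhs : ContDiff ℝ ∞ h) (hgs : ContDiff ℝ ∞ g)
    (hh : ∀ t, HasDerivAt h (g t) t) {w : Plane → Plane} (hw : ContDiff ℝ ∞ w) (x : Plane) :
    curl (pullback h g w) x = g (x 0) * g (x 1) * curl w (coordMap h x) := by
  -- The curl only involves derivatives of a component in the other coordinate direction, along
  -- which the factor `g (x i)` is constant. No term with `g'` appears, and the curl is multiplied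
  -- by the Jacobian.
  have key : ∀ i : Fin 2, ∀ v : Plane, v i = 0 → fderiv ℝ (fun y => pullback h g w y i) x v =
      g (x i) * fderiv ℝ (fun y => w y i) (coordMap h x) (diagCLM (g (x 0)) (g (x 1)) v) := by
    intro i v hv
    have e1 : HasFDerivAt (fun y : Plane => g (y i)) (deriv g (x i) • (EuclideanSpace.proj i : Plane →L[ℝ] ℝ)) x :=
      ((hgs.differentiable (by simp) (x i)).hasDerivAt).comp_hasFDerivAt x
        (EuclideanSpace.proj i : Plane →L[ℝ] ℝ).hasFDerivAt
    have e2 : HasFDerivAt (fun y => w (coordMap h y) i) _ x :=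
      ((contDiff_coord hw i).differentiable (by simp) (coordMap h x)).hasFDerivAt.comp x
        (hasFDerivAt_coordMap hh x)
    simp only [pullback_apply]
    rw [(e1.fun_mul e2).fderiv]
    simp [hv]
  rw [curl_eq (contDiff_pullback hhs hgs hw), curl_eq hw, key 1 _ (by simp), key 0 _ (by simp)]
  have d0 : diagCLM (g (x 0)) (g (x 1)) (EuclideanSpace.single 0 1) =
      g (x 0) • EuclideanSpace.single 0 (1 : ℝ) := by
    ext i; fin_cases i <;> simp [diagCLM_apply]
  have d1 : diagCLM (g (x 0)) (g (x 1)) (EuclideanSpace.single 1 1) =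
      g (x 1) • EuclideanSpace.single 1 (1 : ℝ) := by
    ext i; fin_cases i <;> simp [diagCLM_apply]
  rw [d0, d1, map_smul, map_smul, smul_eq_mul, smul_eq_mul]
  ring

/-- The extended function is `u ∘ F⁻¹` on the range of `F = coordMap h` and zero elsewhere, so only
the range contributes, and the Jacobian of `F` is the product of the two values of `g`. -/
theorem integrable_mul_extend_iff (hh : ∀ t, HasDerivAt h (g t) t) (hg : ∀ t, 0 < g t)
    (u f : Plane → ℝ) :
    Integrable (fun y => Function.extend (coordMap h) u 0 y * f y) ↔
      Integrable fun x => g (x 0) * g (x 1) * (u x * f (coordMap h x)) := by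
  have hinj := injective_coordMap hh hg
  have hd : ∀ x ∈ (univ : Set Plane), HasFDerivWithinAt (coordMap h) (diagCLM (g (x 0)) (g (x 1)))
      univ x := fun x _ => (hasFDerivAt_coordMap hh x).hasFDerivWithinAt
  have hm := (measurable_image_of_fderivWithin MeasurableSet.univ hd hinj.injOn)
  have h1 := integrableOn_image_iff_integrableOn_abs_det_fderiv_smul volume MeasurableSet.univ hd
    hinj.injOn (fun y => Function.extend (coordMap h) u 0 y * f y)
  rw [integrableOn_univ] at h1
  simp only [det_diagCLM, abs_of_pos (mul_pos (hg _) (hg _)), hinj.extend_apply, smul_eq_mul] at h1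
  rw [← h1]
  refine ⟨fun h => h.integrableOn, fun h => (integrableOn_iff_integrable_of_support_subset ?_).1 h⟩
  intro y hy
  by_contra hy'
  refine hy ?_
  simp only
  rw [Function.extend_apply' _ _ _ fun ⟨a, ha⟩ => hy' ⟨a, trivial, ha⟩]
  simp

theorem integral_extend_mul (hh : ∀ t, HasDerivAt h (g t) t) (hg : ∀ t, 0 < g t)
    (u f : Plane → ℝ) :
    ∫ y, Function.extend (coordMap h) u 0 y * f y =
      ∫ x, g (x 0) * g (x 1) * (u x * f (coordMap h x)) := by
  have hinj := injective_coordMap hh hg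
  have hd : ∀ x ∈ (univ : Set Plane), HasFDerivWithinAt (coordMap h) (diagCLM (g (x 0)) (g (x 1)))
      univ x := fun x _ => (hasFDerivAt_coordMap hh x).hasFDerivWithinAt
  have h1 := integral_image_eq_integral_abs_det_fderiv_smul volume MeasurableSet.univ hd
    hinj.injOn (fun y => Function.extend (coordMap h) u 0 y * f y)
  rw [setIntegral_univ] at h1
  simp only [det_diagCLM, abs_of_pos (mul_pos (hg _) (hg _)), hinj.extend_apply, smul_eq_mul] at h1
  rw [← h1, setIntegral_eq_integral_of_forall_compl_eq_zero]
  intro y hy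
  rw [Function.extend_apply' _ _ _ fun ⟨a, ha⟩ => hy ⟨a, trivial, ha⟩]
  simp

end

/-- Competitors can be pushed into a ball without increasing the energy. -/
theorem exists_truncation {M : ℝ} (hM : 0 < M) : ∃ F : Plane → Plane, Continuous F ∧
    Function.Injective F ∧ (∀ x, ‖F x‖ ≤ 99 / 10 * M) ∧
    ∀ (u : Plane → ℝ) (l κ : Measure Plane) (τ : Plane), IsFiniteMeasure l → IsFiniteMeasure κ →
      l (Metric.closedBall 0 M)ᶜ = 0 → Integrable u → CurlDominated u l τ κ →
      Integrable (Function.extend F u 0) ∧ CurlDominated (Function.extend F u 0) l τ (κ.map F) := by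
  obtain ⟨h, g, hhs, hgs, hh, hg0, hg1, hid, hbd⟩ := exists_contraction hM
  have hFc : Continuous (coordMap h) := (contDiff_coordMap hhs).continuous
  refine ⟨coordMap h, hFc, injective_coordMap hh hg0,
    fun x => norm_coordMap_le hbd x hM, fun u l κ τ _ _ hl hu hdom => ⟨?_, fun w hw hwc => ?_⟩⟩
  · have := (integrable_mul_extend_iff hh hg0 u fun _ => 1).2 (by
      simp only [mul_one]
      refine hu.bdd_mul (c := 1) ?_ (Eventually.of_forall fun x => ?_)
      · have h0 : ∀ i : Fin 2, Continuous fun x : Plane => g (x i) := fun i =>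
          hgs.continuous.comp (EuclideanSpace.proj i : Plane →L[ℝ] ℝ).continuous
        exact ((h0 0).mul (h0 1)).aestronglyMeasurable
      · rw [Real.norm_of_nonneg (mul_pos (hg0 _) (hg0 _)).le]
        exact mul_le_one₀ (hg1 _) (hg0 _).le (hg1 _))
    simpa using this
  · obtain ⟨B, hB⟩ := hw.continuous.bounded_above_of_compact_support hwc
    obtain ⟨B', hB'⟩ := (continuous_curl hw).bounded_above_of_compact_support
      (hasCompactSupport_curl hwc)
    -- As `F` has bounded range, the pulled-back field need not have compact support; only its size
    -- and its curl are bounded.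
    have h1 := hdom.of_bounded hu (contDiff_pullback hhs hgs hw)
      (fun x => (norm_pullback_le hg0 hg1 w x).trans (hB _)) (B' := B') (fun x => by
        rw [curl_pullback hhs hgs hh hw, abs_mul, abs_of_pos (mul_pos (hg0 _) (hg0 _))]
        exact (mul_le_of_le_one_left (abs_nonneg _)
          (mul_le_one₀ (hg1 _) (hg0 _).le (hg1 _))).trans (hB' _))
    have e1 : ∫ x, Function.extend (coordMap h) u 0 x * curl w x =
        ∫ x, u x * curl (pullback h g w) x := by
      rw [integral_extend_mul hh hg0]
      refine integral_congr_ae (Eventually.of_forall fun x => ?_)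
      simp only [curl_pullback hhs hgs hh hw]
      ring
    -- `l` lives in the ball of radius `M`, where `F` is the identity and `g = 1`, so the segment
    -- term is unchanged.
    have e2 : ∫ x, inner ℝ τ (w x) ∂l = ∫ x, inner ℝ τ (pullback h g w x) ∂l := by
      have : ∀ᵐ x ∂l, x ∈ Metric.closedBall (0 : Plane) M := hl
      refine integral_congr_ae (this.mono fun x hx => ?_)
      have hc : ∀ i, |x i| ≤ M := fun i =>
        (PiLp.norm_apply_le x i).trans (mem_closedBall_zero_iff.1 hx)
      have hFx : coordMap h x = x := by
        ext i; rw [coordMap_apply, (hid _ (hc i)).1]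
      have : pullback h g w x = w x := by
        ext i; rw [pullback_apply, (hid _ (hc i)).2, one_mul, hFx]
      simp only [this]
    rw [e1, e2]
    refine h1.trans ?_
    rw [integral_map hFc.aemeasurable hw.continuous.norm.aestronglyMeasurable]
    have hi : ∀ f : Plane → Plane, Continuous f → (∀ x, ‖f x‖ ≤ B) → Integrable (fun x => ‖f x‖) κ :=
      fun f hf hfB => Integrable.of_bound hf.norm.aestronglyMeasurable B
        (Eventually.of_forall fun x => by simpa using hfB x)
    exact integral_mono (hi _ (contDiff_pullback hhs hgs hw).continuous fun x =>
      (norm_pullback_le hg0 hg1 w x).trans (hB _)) (hi _ (hw.continuous.comp hFc) fun x => hB _)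
      (norm_pullback_le hg0 hg1 w)

end PlanarSteiner

/-! ### Weak limits of measures and uniform convergence along an ultrafilter. -/

namespace PlanarSteiner

theorem exists_tendsto_ultrafilter {ι : Type*} (𝒰 : Ultrafilter ι) {x : ι → ℝ} {B : ℝ}
    (h : ∀ k, |x k| ≤ B) : ∃ a, Tendsto x 𝒰 (𝓝 a) := by
  obtain ⟨a, -, ha⟩ := (isCompact_Icc (a := -B) (b := B)).ultrafilter_le_nhds (𝒰.map x)
    (tendsto_principal.2 (Eventually.of_forall fun k => abs_le.1 (h k)))
  exact ⟨a, ha⟩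

section Weak

open CompactlySupported

variable {ι : Type*} (𝒰 : Ultrafilter ι)

/-- Bounded sequences of measures have weak limits along ultrafilters. -/
theorem exists_weak_limit (κ : ι → Measure Plane) {a : ι → ℝ≥0∞} {b c : ℝ≥0∞} (hb : b ≠ ⊤)
    (hκ : ∀ k, κ k univ ≤ a k) (hab : ∀ k, a k ≤ b) (ha : Tendsto a 𝒰 (𝓝 c)) :
    ∃ κ' : Measure Plane, κ' univ ≤ c ∧ ∀ f : Plane → ℝ, Continuous f → HasCompactSupport f →
      Tendsto (fun k => ∫ x, f x ∂κ k) 𝒰 (𝓝 (∫ x, f x ∂κ')) := by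
  have hfin : ∀ k, IsFiniteMeasure (κ k) := fun k =>
    ⟨((hκ k).trans (hab k)).trans_lt hb.lt_top⟩
  have hc : c ≠ ⊤ := ((le_of_tendsto ha (Eventually.of_forall hab)).trans_lt hb.lt_top).ne
  have hint : ∀ (f : C_c(Plane, ℝ)) k, Integrable f (κ k) := fun f k =>
    f.continuous.integrable_of_hasCompactSupport f.hasCompactSupport
  have hlim : ∀ f : C_c(Plane, ℝ), ∃ z, Tendsto (fun k => ∫ x, f x ∂κ k) 𝒰 (𝓝 z) := by
    intro f
    obtain ⟨C, hC⟩ := f.continuous.bounded_above_of_compact_support f.hasCompactSupport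
    have hC0 : 0 ≤ C := (norm_nonneg _).trans (hC 0)
    refine exists_tendsto_ultrafilter 𝒰 (B := C * b.toReal) fun k => ?_
    refine (norm_integral_le_of_norm_le_const (Eventually.of_forall hC)).trans ?_
    exact mul_le_mul_of_nonneg_left (ENNReal.toReal_mono hb ((hκ k).trans (hab k))) hC0
  choose L hL using hlim
  let Λ₀ : C_c(Plane, ℝ) →ₗ[ℝ] ℝ :=
    { toFun := L
      map_add' := fun f g => by
        refine tendsto_nhds_unique (hL (f + g)) (((hL f).add (hL g)).congr fun k => ?_)
        rw [← integral_add (hint f k) (hint g k)]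
        rfl
      map_smul' := fun r f => by
        refine tendsto_nhds_unique (hL (r • f)) (((hL f).const_mul r).congr fun k => ?_)
        rw [← integral_const_mul]
        rfl }
  let Λ : C_c(Plane, ℝ) →ₚ[ℝ] ℝ := PositiveLinearMap.mk₀ Λ₀ fun f hf =>
    ge_of_tendsto' (hL f) fun k => integral_nonneg hf
  refine ⟨RealRMK.rieszMeasure Λ, ?_, fun f hf hfc => ?_⟩
  -- Mass may be lost at infinity but not gained: by inner regularity it suffices to test with
  -- functions between `0` and `1` that equal `1` on a compact set.
  · rw [isOpen_univ.measure_eq_iSup_isCompact]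
    refine iSup₂_le fun K _ => iSup_le fun hK => ?_
    obtain ⟨f, hf1, -, hfc, hf01⟩ :=
      exists_continuous_one_zero_of_isCompact hK isClosed_empty (disjoint_empty K)
    let F : C_c(Plane, ℝ) := ⟨f, hfc⟩
    refine (RealRMK.rieszMeasure_le_of_eq_one Λ (f := F) (fun x => (hf01 x).1) hK hf1).trans ?_
    refine ENNReal.ofReal_le_of_le_toReal ?_
    have ha' : Tendsto (fun k => (a k).toReal) 𝒰 (𝓝 c.toReal) := (ENNReal.tendsto_toReal hc).comp ha
    refine le_of_tendsto_of_tendsto' (hL F) ha' fun k => ?_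
    have h1 : ∫ x, F x ∂κ k ≤ ∫ _, (1 : ℝ) ∂κ k :=
      integral_mono (hint F k) (integrable_const _) fun x => (hf01 x).2
    refine h1.trans ?_
    rw [integral_const, smul_eq_mul, mul_one]
    exact ENNReal.toReal_mono ((hab k).trans_lt hb.lt_top).ne (hκ k)
  · let F : C_c(Plane, ℝ) := ⟨⟨f, hf⟩, hfc⟩
    have h1 := RealRMK.integral_rieszMeasure Λ F
    have h2 : ∫ x, f x ∂(RealRMK.rieszMeasure Λ) = L F := h1
    rw [h2]
    exact hL F

end Weak

section Compactness

variable {u : Plane → ℝ} {ν : Measure Plane} {ρ : ContDiffBump (0 : Plane)}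

theorem abs_mollify_le (hu : Integrable u) {S : ℝ} (hS : ∀ x, ρ.normed (volume : Measure Plane) x ≤ S)
    (x : Plane) : |mollify ρ u x| ≤ S * ∫ y, |u y| := by
  rw [mollify_eq, ← integral_const_mul, ← Real.norm_eq_abs]
  refine norm_integral_le_of_norm_le (hu.abs.const_mul S) (Eventually.of_forall fun y => ?_)
  rw [norm_mul, Real.norm_of_nonneg (ρ.nonneg_normed _), Real.norm_eq_abs]
  exact mul_le_mul_of_nonneg_right (hS _) (abs_nonneg _)

/-- At a fixed scale the Lipschitz constant depends on `u` only through the mass of `ν`, which gives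
the equicontinuity for Arzelà–Ascoli. -/
theorem lipschitz_mollify [IsFiniteMeasure ν] (hu : Integrable u) (h : GradBound u ν) {S : ℝ}
    (hS : ∀ x, ρ.normed (volume : Measure Plane) x ≤ S) (x y : Plane) :
    |mollify ρ u x - mollify ρ u y| ≤ S * ν.real univ * ‖x - y‖ := by
  rw [← Real.norm_eq_abs]
  refine Convex.norm_image_sub_le_of_norm_fderiv_le (𝕜 := ℝ) (s := univ)
    (fun z _ => (contDiff_mollify hu).differentiable (by simp) z) (fun z _ => ?_) convex_univ
    (mem_univ y) (mem_univ x)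
  refine (norm_fderiv_mollify_le hu h z).trans ?_
  have h1 : ∫ w, ρ.normed (volume : Measure Plane) (z - w) ∂ν ≤ ∫ _, S ∂ν :=
    integral_mono (integrable_of_smooth (contDiff_normed_sub z) (hasCompactSupport_normed_sub z) ν)
      (integrable_const _) fun w => hS _
  refine h1.trans_eq ?_
  rw [integral_const, smul_eq_mul, mul_comm]

theorem mollify_eq_zero {R : ℝ} (hsupp : ∀ x ∉ Metric.closedBall (0 : Plane) R, u x = 0) {x : Plane}
    (hx : x ∉ Metric.closedBall (0 : Plane) (R + ρ.rOut)) : mollify ρ u x = 0 := by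
  rw [mollify_eq]
  refine integral_eq_zero_of_ae (Eventually.of_forall fun y => ?_)
  by_cases hy : y ∈ Metric.closedBall (0 : Plane) R
  · have : ρ.normed (volume : Measure Plane) (x - y) = 0 := by
      have h1 : x - y ∉ Function.support (ρ.normed (volume : Measure Plane)) := by
        rw [ρ.support_normed_eq, Metric.mem_ball, dist_zero_right, not_lt]
        rw [mem_closedBall_zero_iff] at hx hy
        have := norm_sub_norm_le x y
        linarith
      simpa using h1
    simp [this]
  · simp [hsupp y hy]

/-- Along an ultrafilter, equibounded equi-Lipschitz functions converge uniformly on compact sets. -/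
theorem eventually_sub_le_of_lipschitz {ι : Type*} (𝒰 : Ultrafilter ι) {f : ι → Plane → ℝ} {B A : ℝ}
    (hB : ∀ k x, |f k x| ≤ B) (hA : ∀ k x y, |f k x - f k y| ≤ A * ‖x - y‖) {K : Set Plane}
    (hK : IsCompact K) {ε : ℝ} (hε : 0 < ε) :
    ∃ g : Plane → ℝ, Continuous g ∧ ∀ᶠ k in (𝒰 : Filter ι), ∀ x ∈ K, |f k x - g x| ≤ ε := by
  choose g hg using fun x => exists_tendsto_ultrafilter 𝒰 fun k => hB k x
  have hA' : ∀ x y, |g x - g y| ≤ A * ‖x - y‖ := fun x y =>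
    le_of_tendsto ((hg x).sub (hg y)).abs (Eventually.of_forall fun k => hA k x y)
  refine ⟨g, (LipschitzWith.of_dist_le' fun x y => by
    rw [Real.dist_eq, dist_eq_norm]; exact hA' x y).continuous, ?_⟩
  -- On this net the Lipschitz errors of `f k` and of `g` are at most `ε/4` each; the remaining
  -- `ε/2` is for convergence at the finitely many centres.
  obtain ⟨t, -, htf, ht⟩ := hK.finite_cover_balls (e := ε / (4 * (|A| + 1))) (by positivity)
  have h1 : ∀ᶠ k in (𝒰 : Filter ι), ∀ z ∈ t, |f k z - g z| < ε / 2 := by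
    rw [Filter.eventually_all_finite htf]
    intro z _
    have := (((hg z).sub_const (g z)).abs)
    rw [sub_self, abs_zero] at this
    exact this.eventually (gt_mem_nhds (by positivity))
  filter_upwards [h1] with k hk x hx
  obtain ⟨z, hz, hxz⟩ := mem_iUnion₂.1 (ht hx)
  rw [mem_ball_iff_norm, lt_div_iff₀ (by positivity)] at hxz
  have h2 := hA k x z
  have h3 := hA' z x
  rw [norm_sub_rev] at h3
  have h4 : A * ‖x - z‖ ≤ ε / 4 := by nlinarith [le_abs_self A, norm_nonneg (x - z)]
  have h5 := hk z hz
  have h6 := abs_sub_le (f k x) (f k z) (g x)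
  have h7 := abs_sub_le (f k z) (g z) (g x)
  linarith

end Compactness

end PlanarSteiner

/-! ### Compactness in `L¹` of integer-valued functions of bounded variation. -/

namespace PlanarSteiner

/-- Integers satisfy `|n| ≤ n²`, so the Sobolev bound controls the `L¹` norm as well. -/
theorem lintegral_int_le_sq (u : Plane → ℤ) :
    ∫⁻ x, ‖(u x : ℝ)‖ₑ ≤ eLpNorm (fun x => (u x : ℝ)) 2 volume ^ 2 := by
  have h := eLpNorm_nnreal_pow_eq_lintegral (μ := (volume : Measure Plane)) (p := 2)
    (f := fun x => (u x : ℝ)) two_ne_zero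
  simp only [NNReal.coe_ofNat, ENNReal.coe_ofNat, ENNReal.rpow_ofNat] at h
  rw [h]
  refine lintegral_mono fun x => ?_
  rcases eq_or_ne (u x) 0 with hx | hx
  · simp [hx]
  · have h1 : (1 : ℝ≥0∞) ≤ ‖(u x : ℝ)‖ₑ := by
      rw [← ofReal_norm, ENNReal.one_le_ofReal, Real.norm_eq_abs]
      exact_mod_cast Int.one_le_abs hx
    rw [sq]
    exact le_mul_of_one_le_right bot_le h1

theorem lintegral_indicator_sub_le {f g : Plane → ℝ} {K : Set Plane} (hK : MeasurableSet K)
    (hf : ∀ x ∉ K, f x = 0) {δ : ℝ} (h : ∀ x ∈ K, |f x - g x| ≤ δ) :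
    ∫⁻ x, ‖f x - K.indicator g x‖ₑ ≤ ENNReal.ofReal δ * volume K := by
  rw [← setLIntegral_const, ← lintegral_indicator hK]
  refine lintegral_mono fun x => ?_
  by_cases hx : x ∈ K
  · rw [indicator_of_mem hx, indicator_of_mem hx, ← ofReal_norm]
    exact ENNReal.ofReal_le_ofReal (h x hx)
  · simp [hx, hf x hx]

variable {ι : Type*} (𝒰 : Ultrafilter ι)

/-- Mollification shows that integer valued functions of equibounded variation are totally bounded
in `L¹`. -/
theorem exists_lintegral_sub_le {R : ℝ} {C : ℝ≥0∞} (hC : C ≠ ⊤) {u : ι → Plane → ℤ}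
    {ν : ι → Measure Plane} (hu : ∀ k, Integrable fun x => (u k x : ℝ))
    (hsupp : ∀ k, ∀ x ∉ Metric.closedBall (0 : Plane) R, u k x = 0) (hν : ∀ k, ν k univ ≤ C)
    (hgrad : ∀ k, GradBound (fun x => (u k x : ℝ)) (ν k)) {ε : ℝ≥0∞} (hε : ε ≠ 0) :
    ∃ g : Plane → ℝ, Measurable g ∧
      ∀ᶠ k in (𝒰 : Filter ι), ∫⁻ x, ‖(u k x : ℝ) - g x‖ₑ ≤ ε := by
  have hfin : ∀ k, IsFiniteMeasure (ν k) := fun k => ⟨(hν k).trans_lt hC.lt_top⟩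
  obtain ⟨K, hK, hsob⟩ := exists_sobolev_const
  have hcs : ∀ k, HasCompactSupport fun x => (u k x : ℝ) := fun k =>
    HasCompactSupport.intro (isCompact_closedBall 0 R) fun x hx => by simp [hsupp k x hx]
  have hL1 : ∀ k, ∫ x, |(u k x : ℝ)| ≤ ((K * C) ^ 2).toReal := by
    intro k
    have h1 := integral_norm_eq_lintegral_enorm (hu k).1
    simp only [Real.norm_eq_abs] at h1
    rw [h1]
    refine ENNReal.toReal_mono (ENNReal.pow_ne_top (ENNReal.mul_ne_top hK hC)) ?_
    refine (lintegral_int_le_sq (u k)).trans ?_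
    gcongr
    exact (hsob _ _ (hfin k) (hu k) (hcs k) (hgrad k)).trans (by gcongr; exact hν k)
  have hε2 : ε / 2 ≠ 0 := by simpa using hε
  have hlim : Tendsto (fun m : ℕ => ENNReal.ofReal (bumpSeq m).rOut * C) atTop (𝓝 0) := by
    have h1 : Tendsto (fun m : ℕ => ENNReal.ofReal (bumpSeq m).rOut) atTop (𝓝 0) := by
      rw [← ENNReal.ofReal_zero]
      exact (ENNReal.continuous_ofReal.tendsto 0).comp tendsto_one_div_add_atTop_nhds_zero_nat
    simpa using ENNReal.Tendsto.mul_const h1 (Or.inr hC)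
  -- The scale is fixed once for all `k`: half of `ε` pays for mollification, the other half for
  -- uniform convergence at that scale.
  obtain ⟨m, hm⟩ := (hlim.eventually (gt_mem_nhds (pos_iff_ne_zero.2 hε2))).exists
  set ρ := bumpSeq m
  set B := Metric.closedBall (0 : Plane) (R + ρ.rOut)
  have hBm : MeasurableSet B := Metric.isClosed_closedBall.measurableSet
  have hlimδ : Tendsto (fun j : ℕ => ENNReal.ofReal (1 / (j + 1)) * volume B) atTop (𝓝 0) := by
    have h1 : Tendsto (fun j : ℕ => ENNReal.ofReal (1 / (j + 1))) atTop (𝓝 0) := by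
      rw [← ENNReal.ofReal_zero]
      exact (ENNReal.continuous_ofReal.tendsto 0).comp tendsto_one_div_add_atTop_nhds_zero_nat
    simpa using ENNReal.Tendsto.mul_const h1 (Or.inr (measure_closedBall_lt_top (μ := volume)).ne)
  obtain ⟨j, hj⟩ := (hlimδ.eventually (gt_mem_nhds (pos_iff_ne_zero.2 hε2))).exists
  obtain ⟨S, hS⟩ := (ρ.continuous_normed (μ := (volume : Measure Plane))).bounded_above_of_compact_support
    ρ.hasCompactSupport_normed
  have hS' : ∀ x, ρ.normed (volume : Measure Plane) x ≤ S := fun x => (le_abs_self _).trans (hS x)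
  have hS0 : 0 ≤ S := (norm_nonneg _).trans (hS 0)
  obtain ⟨g, hgc, hg⟩ := eventually_sub_le_of_lipschitz 𝒰
    (f := fun k => mollify ρ fun x => (u k x : ℝ)) (B := S * ((K * C) ^ 2).toReal)
    (A := S * C.toReal)
    (fun k x => (abs_mollify_le (hu k) hS' x).trans (mul_le_mul_of_nonneg_left (hL1 k) hS0))
    (fun k x y => (lipschitz_mollify (hu k) (hgrad k) hS' x y).trans (by
      gcongr
      exact ENNReal.toReal_mono hC (hν k)))
    (isCompact_closedBall 0 (R + ρ.rOut)) (ε := 1 / (j + 1)) (by positivity)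
  refine ⟨B.indicator g, hgc.measurable.indicator hBm, ?_⟩
  filter_upwards [hg] with k hk
  have e1 : ∫⁻ x, ‖mollify ρ (fun y => (u k y : ℝ)) x - B.indicator g x‖ₑ ≤ ε / 2 :=
    (lintegral_indicator_sub_le hBm (fun x hx =>
      mollify_eq_zero (fun y hy => by simp [hsupp k y hy]) hx) hk).trans hj.le
  have e2 : ∫⁻ x, ‖mollify ρ (fun y => (u k y : ℝ)) x - u k x‖ₑ ≤ ε / 2 :=
    (lintegral_sub_mollify_le (hu k) (hgrad k)).trans ((by gcongr; exact hν k :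
      ENNReal.ofReal ρ.rOut * ν k univ ≤ ENNReal.ofReal ρ.rOut * C).trans hm.le)
  have hmeas : AEMeasurable fun x => ‖mollify ρ (fun y => (u k y : ℝ)) x - u k x‖ₑ :=
    ((contDiff_mollify (hu k)).continuous.aestronglyMeasurable.sub (hu k).1).enorm
  calc ∫⁻ x, ‖(u k x : ℝ) - B.indicator g x‖ₑ
      ≤ ∫⁻ x, (‖mollify ρ (fun y => (u k y : ℝ)) x - u k x‖ₑ +
        ‖mollify ρ (fun y => (u k y : ℝ)) x - B.indicator g x‖ₑ) := by
        refine lintegral_mono fun x => ?_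
        rw [← edist_eq_enorm_sub, ← edist_eq_enorm_sub, ← edist_eq_enorm_sub]
        exact edist_triangle_left _ _ _
    _ ≤ ε / 2 + ε / 2 := by
        rw [lintegral_add_left' hmeas]
        exact add_le_add e2 e1
    _ = ε := ENNReal.add_halves ε

/-- Approximation by a single function within every `ε` makes the image of the ultrafilter Cauchy in
the complete space `L¹`. -/
theorem exists_L1_limit {R : ℝ} {C : ℝ≥0∞} (hC : C ≠ ⊤) {u : ι → Plane → ℤ}
    {ν : ι → Measure Plane} (hu : ∀ k, Integrable fun x => (u k x : ℝ))
    (hsupp : ∀ k, ∀ x ∉ Metric.closedBall (0 : Plane) R, u k x = 0) (hν : ∀ k, ν k univ ≤ C)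
    (hgrad : ∀ k, GradBound (fun x => (u k x : ℝ)) (ν k)) :
    ∃ v : Plane → ℤ, (Integrable fun x => (v x : ℝ)) ∧
      (∀ x ∉ Metric.closedBall (0 : Plane) R, v x = 0) ∧
      Tendsto (fun k => ∫⁻ x, ‖(u k x : ℝ) - v x‖ₑ) 𝒰 (𝓝 0) := by
  let T : ι → Lp ℝ 1 (volume : Measure Plane) := fun k => (hu k).toL1 _
  have hcauchy : Cauchy (map T 𝒰) := by
    rw [EMetric.cauchy_iff]
    refine ⟨(𝒰.map T).neBot.ne, fun ε hε => ?_⟩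
    obtain ⟨ε', hε'0, hε'⟩ := ENNReal.lt_iff_exists_add_pos_lt.1 hε |>.elim fun r hr =>
      (⟨r / 2, by simpa using hr.1.ne', by
        rw [ENNReal.add_halves]; simpa using hr.2⟩ : ∃ ε' : ℝ≥0∞, ε' ≠ 0 ∧ ε' + ε' < ε)
    obtain ⟨g, hg, hgk⟩ := exists_lintegral_sub_le 𝒰 hC hu hsupp hν hgrad hε'0
    refine ⟨T '' {k | ∫⁻ x, ‖(u k x : ℝ) - g x‖ₑ ≤ ε'}, image_mem_map hgk, ?_⟩
    rintro _ ⟨k, hk, rfl⟩ _ ⟨k', hk', rfl⟩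
    refine lt_of_le_of_lt ?_ hε'
    rw [Integrable.edist_toL1_toL1]
    have hmeas : AEMeasurable fun x => ‖(u k x : ℝ) - g x‖ₑ :=
      ((hu k).1.sub hg.aestronglyMeasurable).enorm
    refine le_trans ?_ (add_le_add hk hk')
    rw [← lintegral_add_left' hmeas]
    refine lintegral_mono fun x => ?_
    rw [← edist_eq_enorm_sub, ← edist_eq_enorm_sub]
    exact edist_triangle_right _ _ _
  obtain ⟨V, hV⟩ := CompleteSpace.complete hcauchy
  have hV1 : Integrable V := L1.integrable_coeFn V
  have hVlim : Tendsto (fun k => ∫⁻ x, ‖(u k x : ℝ) - V x‖ₑ) 𝒰 (𝓝 0) := by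
    have h1 : Tendsto T 𝒰 (𝓝 V) := hV
    have h2 := tendsto_iff_edist_tendsto_0.1 h1
    refine h2.congr fun k => ?_
    conv_lhs => rw [← Integrable.toL1_coeFn V hV1]
    rw [Integrable.edist_toL1_toL1]
    simp only [edist_eq_enorm_sub]
  set B := Metric.closedBall (0 : Plane) R
  have hBm : MeasurableSet B := Metric.isClosed_closedBall.measurableSet
  -- Rounding gives integer values at every point, not only almost everywhere; it at most doubles
  -- the distance to each `u k`, so the limit is unchanged.
  let v : Plane → ℤ := B.indicator fun x => round (V x)
  have hle : ∀ k, ∫⁻ x, ‖(u k x : ℝ) - v x‖ₑ ≤ 2 * ∫⁻ x, ‖(u k x : ℝ) - V x‖ₑ := by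
    intro k
    rw [← lintegral_const_mul' _ _ (by simp)]
    refine lintegral_mono fun x => ?_
    by_cases hx : x ∈ B
    · have h1 := abs_sub_round_le_two_mul (u k x) (V x)
      simp only [v, indicator_of_mem hx]
      rw [← ofReal_norm, ← ofReal_norm, Real.norm_eq_abs, Real.norm_eq_abs]
      refine (ENNReal.ofReal_le_ofReal h1).trans_eq ?_
      rw [ENNReal.ofReal_mul (by norm_num)]
      simp
    · simp [v, hx, hsupp k x hx]
  have hvlim : Tendsto (fun k => ∫⁻ x, ‖(u k x : ℝ) - v x‖ₑ) 𝒰 (𝓝 0) := by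
    refine tendsto_of_tendsto_of_tendsto_of_le_of_le tendsto_const_nhds ?_ (fun _ => bot_le) hle
    simpa using ENNReal.Tendsto.const_mul hVlim (Or.inr (by simp : (2 : ℝ≥0∞) ≠ ⊤))
  refine ⟨v, ?_, fun x hx => indicator_of_notMem hx _, hvlim⟩
  have hround : Measurable fun t : ℝ => (round t : ℤ) := by
    simp only [round_eq]
    exact Int.measurable_floor.comp (measurable_id.add_const _)
  have hvm : AEStronglyMeasurable fun x => (v x : ℝ) := by
    have h1 : (fun x => (v x : ℝ)) = B.indicator fun x => ((round (V x) : ℤ) : ℝ) := by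
      funext x
      by_cases hx : x ∈ B <;> simp [v, hx]
    rw [h1]
    exact ((measurable_from_top (f := fun n : ℤ => (n : ℝ))).comp hround |>.comp_aemeasurable
      hV1.1.aemeasurable).aestronglyMeasurable.indicator hBm
  obtain ⟨k, hk⟩ := (hvlim.eventually (gt_mem_nhds one_pos)).exists
  have hdiff : Integrable fun x => (u k x : ℝ) - v x :=
    ⟨(hu k).1.sub hvm, hk.trans ENNReal.one_lt_top⟩
  exact ((hu k).sub hdiff).congr (Eventually.of_forall fun x => by simp)

theorem tendsto_integral_mul {u : ι → Plane → ℝ} {v f : Plane → ℝ} (hu : ∀ k, Integrable (u k))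
    (hv : Integrable v) (h : Tendsto (fun k => ∫⁻ x, ‖u k x - v x‖ₑ) 𝒰 (𝓝 0))
    (hf : Continuous f) (hfc : HasCompactSupport f) :
    Tendsto (fun k => ∫ x, u k x * f x) 𝒰 (𝓝 (∫ x, v x * f x)) := by
  obtain ⟨C, hC⟩ := hf.bounded_above_of_compact_support hfc
  refine tendsto_integral_of_L1 _ (integrable_mul_of_continuous_hasCompactSupport hv hf hfc).1
    (Eventually.of_forall fun k => integrable_mul_of_continuous_hasCompactSupport (hu k) hf hfc) ?_
  refine tendsto_of_tendsto_of_tendsto_of_le_of_le tendsto_const_nhds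
    (h := fun k => ENNReal.ofReal C * ∫⁻ x, ‖u k x - v x‖ₑ) ?_ (fun _ => bot_le) fun k => ?_
  · simpa using ENNReal.Tendsto.const_mul h (Or.inr ENNReal.ofReal_ne_top)
  · simp only
    rw [← lintegral_const_mul' _ _ ENNReal.ofReal_ne_top]
    refine lintegral_mono fun x => ?_
    rw [← sub_mul, enorm_mul, mul_comm, ← ofReal_norm (f x)]
    gcongr
    exact hC x

end PlanarSteiner

/-! ### Lower semicontinuity and existence of a minimizer. -/

namespace PlanarSteiner

theorem memSBVInt_zero {n : ℕ} : MemSBVInt (0 : Plane → Fin n → ℤ) := by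
  intro i
  refine MemBV.memSBV_of_int (u := fun _ => 0) ⟨by simp, 0, fun φ hφ hc => ?_⟩
  simp

theorem memSBVInt_iff {n : ℕ} {U : Plane → Fin n → ℤ} :
    MemSBVInt U ↔ ∀ i, MemBV fun x => (U x i : ℝ) :=
  ⟨fun h i => (h i).toMemBV, fun h i => (h i).memSBV_of_int⟩

theorem isFiniteMeasure_segment (p q : Plane) :
    IsFiniteMeasure ((μH[1] : Measure Plane).restrict (segment ℝ p q)) :=
  ⟨by rw [Measure.restrict_apply_univ, MeasureTheory.hausdorffMeasure_segment]; exact edist_lt_top _ _⟩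

theorem segment_compl_closedBall {p q : Plane} {M : ℝ} (hp : ‖p‖ ≤ M) (hq : ‖q‖ ≤ M) :
    (μH[1] : Measure Plane).restrict (segment ℝ p q) (Metric.closedBall 0 M)ᶜ = 0 := by
  rw [Measure.restrict_apply Metric.isClosed_closedBall.measurableSet.compl]
  have : segment ℝ p q ⊆ Metric.closedBall 0 M :=
    (convex_closedBall (0 : Plane) M).segment_subset (by simpa using hp) (by simpa using hq)
  rw [(disjoint_compl_left_iff_subset.2 this).inter_eq, measure_empty]

/-- Lower semicontinuity and compactness: bounded families of competitors supported in a fixed ball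
have a limit whose energy is at most the limit of the energies. -/
theorem exists_limit_competitor {n : ℕ} {R : ℝ} {l : Fin n → Measure Plane} {τ : Fin n → Plane}
    (hl : ∀ i, IsFiniteMeasure (l i)) (hτ : ∀ i, ‖τ i‖ ≤ 1) {u : ℕ → Fin n → Plane → ℤ}
    {κ : ℕ → Measure Plane} {a : ℕ → ℝ≥0∞} {b c : ℝ≥0∞} (hb : b ≠ ⊤)
    (hu : ∀ k i, Integrable fun x => (u k i x : ℝ))
    (hsupp : ∀ k i, ∀ x ∉ Metric.closedBall (0 : Plane) R, u k i x = 0)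
    (hdom : ∀ k i, CurlDominated (fun x => (u k i x : ℝ)) (l i) (τ i) (κ k))
    (hκ : ∀ k, κ k univ ≤ a k) (hab : ∀ k, a k ≤ b) (ha : Tendsto a atTop (𝓝 c)) :
    ∃ (v : Fin n → Plane → ℤ) (κ' : Measure Plane), κ' univ ≤ c ∧
      (∀ i, ∀ x ∉ Metric.closedBall (0 : Plane) R, v i x = 0) ∧
      (∀ i, Integrable fun x => (v i x : ℝ)) ∧
      ∀ i, CurlDominated (fun x => (v i x : ℝ)) (l i) (τ i) κ' := by
  have hfin : ∀ k, IsFiniteMeasure (κ k) := fun k =>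
    ⟨((hκ k).trans (hab k)).trans_lt hb.lt_top⟩
  let 𝒰 : Ultrafilter ℕ := hyperfilter ℕ
  have h𝒰 : (𝒰 : Filter ℕ) ≤ atTop := Nat.hyperfilter_le_atTop
  obtain ⟨κ', hκ', hlim⟩ := exists_weak_limit 𝒰 κ hb hκ hab (ha.mono_left h𝒰)
  choose v hv1 hv2 hv3 using fun i => exists_L1_limit 𝒰 (C := b + l i univ)
    (ENNReal.add_ne_top.2 ⟨hb, measure_ne_top _ _⟩) (fun k => hu k i) (fun k => hsupp k i)
    (ν := fun k => κ k + l i)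
    (fun k => by rw [Measure.add_apply]; gcongr; exact (hκ k).trans (hab k))
    (fun k => (hdom k i).gradBound (hτ i))
  refine ⟨v, κ', hκ', hv2, hv1, fun i w hw hc => ?_⟩
  -- For a fixed field both sides converge along the ultrafilter, and the segment term does not
  -- depend on `k`; domination is thus a closed condition.
  refine le_of_tendsto_of_tendsto' ((tendsto_integral_mul 𝒰 (fun k => hu k i) (hv1 i) (hv3 i)
    (continuous_curl hw) (hasCompactSupport_curl hc)).add_const _).abs
    (hlim _ hw.continuous.norm hc.norm) fun k => hdom k i w hw hc

end PlanarSteiner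

open PlanarSteiner in
theorem mainTheorem6 (n : ℕ) (hn : 2 ≤ n) (P : Fin (n + 1) → PlanarSteiner.Plane)
    (hP : Function.Injective P) :
    ∃ U : PlanarSteiner.Plane → Fin n → ℤ,
      PlanarSteiner.MemSBVInt U ∧
      PlanarSteiner.F0 P U =
        ⨅ V ∈ {V : PlanarSteiner.Plane → Fin n → ℤ | PlanarSteiner.MemSBVInt V},
          PlanarSteiner.F0 P V ∧
      tsupport U ⊆ Metric.ball 0 (10 * ⨆ i, ‖P i‖) := by
  set I : ℝ≥0∞ := ⨅ V ∈ {V : Plane → Fin n → ℤ | MemSBVInt V}, F0 P V with hI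
  have hIle : ∀ V : Plane → Fin n → ℤ, MemSBVInt V → I ≤ F0 P V := fun V hV => iInf₂_le V hV
  rcases eq_or_ne I ⊤ with htop | htop
  -- If the infimum were infinite, zero would already be a minimizer; finiteness of the energy need
  -- not be proved.
  · refine ⟨0, memSBVInt_zero, ?_, ?_⟩
    · rw [htop]
      exact top_le_iff.1 (htop ▸ hIle 0 memSBVInt_zero)
    · rw [tsupport_eq_empty_iff.2 rfl]
      exact empty_subset _
  set M : ℝ := ⨆ i, ‖P i‖ with hM
  have hPM : ∀ i, ‖P i‖ ≤ M := fun i => le_ciSup (Finite.bddAbove_range fun i => ‖P i‖) i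
  have hM0 : 0 < M := by
    by_contra! hM0
    have h0 : ∀ i, P i = 0 := fun i => norm_le_zero_iff.1 ((hPM i).trans hM0)
    have := hP ((h0 0).trans (h0 (Fin.last n)).symm)
    have := congrArg Fin.val this
    simp at this
    omega
  let l : Fin n → Measure Plane := fun i =>
    (μH[1]).restrict (segment ℝ (P i.castSucc) (P (Fin.last n)))
  let τ : Fin n → Plane := fun i =>
    ‖P (Fin.last n) - P i.castSucc‖⁻¹ • (P (Fin.last n) - P i.castSucc)
  have hl : ∀ i, IsFiniteMeasure (l i) := fun i => isFiniteMeasure_segment _ _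
  have hl0 : ∀ i, l i (Metric.closedBall 0 M)ᶜ = 0 := fun i =>
    segment_compl_closedBall (hPM _) (hPM _)
  have hτ : ∀ i, ‖τ i‖ ≤ 1 := fun i => by
    simp only [τ]
    rw [norm_smul, norm_inv, norm_norm]
    exact inv_mul_le_one
  have hpos : ∀ k : ℕ, (0 : ℝ≥0∞) < ((k : ℝ≥0∞) + 1)⁻¹ := fun k => by
    simp [ENNReal.inv_pos]
  have hex : ∀ k : ℕ, ∃ V : Plane → Fin n → ℤ, MemSBVInt V ∧ F0 P V < I + ((k : ℝ≥0∞) + 1)⁻¹ := by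
    intro k
    have h1 : I < I + ((k : ℝ≥0∞) + 1)⁻¹ := ENNReal.lt_add_right htop (hpos k).ne'
    rw [hI] at h1
    simp only [iInf_lt_iff, exists_prop] at h1
    obtain ⟨V, hV, h2⟩ := h1
    exact ⟨V, hV, h2⟩
  choose V hV hVI using hex
  -- One measure dominates all components and its mass is the energy, so the limit argument never
  -- handles the supremum itself.
  let κ : ℕ → Measure Plane := fun k => ⨆ i : Fin n, (orthGradient (fun x => (V k x i : ℝ)) -
    segmentMeasure (P i.castSucc) (P (Fin.last n))).variation
  have hle1 : ∀ k : ℕ, I + ((k : ℝ≥0∞) + 1)⁻¹ ≤ I + 1 := fun k => by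
    gcongr
    exact ENNReal.inv_le_one.2 (by simp)
  have hItop : I + 1 ≠ ⊤ := ENNReal.add_ne_top.2 ⟨htop, ENNReal.one_ne_top⟩
  have hκ : ∀ k, κ k univ ≤ I + ((k : ℝ≥0∞) + 1)⁻¹ := fun k => (hVI k).le
  have hκfin : ∀ k, IsFiniteMeasure (κ k) := fun k =>
    ⟨((hκ k).trans (hle1 k)).trans_lt hItop.lt_top⟩
  obtain ⟨F, hFc, hFi, hFn, hF⟩ := exists_truncation hM0
  have hcast : ∀ k i, Function.extend F (fun x => (V k x i : ℝ)) 0 =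
      fun x => ((Function.extend F (fun x => V k x i) 0 x : ℤ) : ℝ) := by
    intro k i
    funext x
    by_cases hx : ∃ y, F y = x
    · obtain ⟨y, rfl⟩ := hx
      rw [hFi.extend_apply, hFi.extend_apply]
    · rw [Function.extend_apply' _ _ _ hx, Function.extend_apply' _ _ _ hx]
      simp
  have htrunc : ∀ k i, (Integrable fun x => ((Function.extend F (fun x => V k x i) 0 x : ℤ) : ℝ)) ∧
      CurlDominated (fun x => ((Function.extend F (fun x => V k x i) 0 x : ℤ) : ℝ)) (l i) (τ i)
        ((κ k).map F) := by
    intro k i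
    rw [← hcast]
    exact hF _ _ _ _ (hl i) (hκfin k) (hl0 i) (hV k i).integrable
      (curlDominated_of_variation_le (hV k i).toMemBV
        (le_iSup (fun i : Fin n => (orthGradient (fun x => (V k x i : ℝ)) -
          segmentMeasure (P i.castSucc) (P (Fin.last n))).variation) i))
  have hlim : Tendsto (fun k : ℕ => I + ((k : ℝ≥0∞) + 1)⁻¹) atTop (𝓝 I) := by
    have h1 : Tendsto (fun k : ℕ => ((k : ℝ≥0∞) + 1)⁻¹) atTop (𝓝 0) := by
      have := (tendsto_add_atTop_iff_nat (f := fun k : ℕ => ((k : ℝ≥0∞))⁻¹) 1).2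
        ENNReal.tendsto_inv_nat_nhds_zero
      simpa using this
    simpa using h1.const_add I
  obtain ⟨v, κ', hκ', hv0, hvi, hvd⟩ := exists_limit_competitor (R := 99 / 10 * M) hl hτ hItop
    (fun k i => (htrunc k i).1) (fun k i x hx => Function.extend_apply' _ _ _ fun ⟨y, hy⟩ =>
      hx (by rw [← hy, mem_closedBall_zero_iff]; exact hFn y)) (fun k i => (htrunc k i).2)
    (a := fun k : ℕ => I + ((k : ℝ≥0∞) + 1)⁻¹)
    (fun k => by rw [Measure.map_apply hFc.measurable MeasurableSet.univ]; exact hκ k) hle1 hlim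
  have hκ'fin : IsFiniteMeasure κ' := ⟨hκ'.trans_lt htop.lt_top⟩
  have hvar := fun i => variation_le_of_curlDominated (hvi i) (hvd i)
  have hmem : MemSBVInt fun x i => v i x := memSBVInt_iff.2 fun i => (hvar i).1
  refine ⟨fun x i => v i x, hmem, le_antisymm ?_ (hIle _ hmem), ?_⟩
  -- The limit measure bounds every component's variation, so it bounds their lattice supremum,
  -- whose mass is the energy of the limit.
  · exact (iSup_le (a := κ') fun i => (hvar i).2 : _ ≤ κ') univ |>.trans hκ'
  · have hsub : tsupport (fun x i => v i x : Plane → Fin n → ℤ) ⊆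
        Metric.closedBall 0 (99 / 10 * M) := by
      refine closure_minimal (fun x hx => ?_) Metric.isClosed_closedBall
      by_contra hx'
      exact hx (funext fun i => hv0 i x hx')
    exact hsub.trans (Metric.closedBall_subset_ball (by linarith))

end
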